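/- Fix a prime number $p$. Let $K$ be an algebraic extension of $\mathbb Q$ (of finite or infinite degree). A prime of an algebraic extension $F$ of $\mathbb Q$ is either a nonzero prime ideal of its ring of integers or an archimedean place; an archimedean place is ramified in an extension exactly when it is real and becomes complex. Let $S,T$ be sets of primes of $K$ with $S\cap T=\emptyset$, and let $F$ be an algebraic extension of $K$. Denote by $L_{S,\infty}^T(F)$ the maximal abelian pro-$p$-extension of $F$ that is unramified outside the primes lying over $S$ and totally decomposed at all primes lying over $T$. For a positive integer $e$ let $L_{S,e}^T(F)/F$ be the maximal subextension of $L_{S,\infty}^T(F)/F$ whose Galois group has exponent dividing $p^e$. For $e\in\{1,2,3,\dots\}\cup\{\infty\}$ put $A_{S,e}^T(F)=\mathrm{Gal}(L_{S,e}^T(F)/F)$. **Theorem.** Let $K$ be an algebraic extension of $\mathbb Q$ and let $\Sigma,S,T$ be sets of primes of $K$ with $S\cap T=\emptyset$. Let $K''/K$ be a cyclic extension of degree $p^2$ unramified outside $\Sigma$, and let $K'$ be its unique intermediate field with $[K':K]=p$. Assume that 1. $(\Sigma\setminus S)\cup T\neq\emptyset$; 2. $K''/K$ is totally ramified at all primes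 lying over $\Sigma\setminus(S\cup T)$; 3. no prime in $T$ splits in $K'/K$ (that is, exactly one prime of $K'$ lies over it). Then for each $e\in\{1,2,3,\dots\}\cup\{\infty\}$ (all extensions being taken inside a fixed algebraic closure of $K$): - $L_{S,e}^T(K)\subseteq L_{S,e}^T(K')\subseteq L_{S,e}^T(K'')\subseteq L_{S,e}^{\Sigma\cap T}(K'')$, and the restriction mapping $\rho_e:A_{S,e}^T(K')\to A_{S,e}^T(K)$ is surjective. - If $\rho_e$ is an isomorphism, then the restriction mappings $A_{S,e}^T(K'')\to A_{S,e}^T(K')\to A_{S,e}^T(K)$ are isomorphisms of topological groups. If moreover $\Sigma\setminus S\neq\emptyset$, then the restriction mapping $A_{S,e}^{\Sigma\cap T}(K'')\to A_{S,e}^T(K'')$ is an isomorphism of topological groups as well. -/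

import Mathlib

open scoped NumberField Pointwise

namespace ClassStability

/-- The primes of a field `F` (used for algebraic extensions of `ℚ`, of finite or infinite degree):
the nonzero prime ideals of the ring of integers, and the archimedean places. -/
inductive Place (F : Type*) [Field F]
  | finite (Q : IsDedekindDomain.HeightOneSpectrum (𝓞 F)) : Place F
  | infinite (w : NumberField.InfinitePlace F) : Place F

namespace Place

/-- The prime `w` of `E` lies over the prime `v` of `F`. -/
def LiesOver {F E : Type*} [Field F] [Field E] [Algebra F E] : Place E → Place F → Prop
  | finite Q, finite P => Q.asIdeal.comap (algebraMap (𝓞 F) (𝓞 E)) = P.asIdeal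
  | infinite w, infinite v => w.comap (algebraMap F E) = v
  | _, _ => False

/-- The decomposition group of `w` in `Gal(E/F)`. -/
def decompositionGroup (F : Type*) {E : Type*} [Field F] [Field E] [Algebra F E] :
    Place E → Subgroup Gal(E/F)
  | finite Q => MulAction.stabilizer Gal(E/F) Q.asIdeal
  | infinite w => MulAction.stabilizer Gal(E/F) w

/-- The inertia group of `w` in `Gal(E/F)`. At a nonarchimedean prime `Q` it consists of the `σ`
with `σ x ≡ x` modulo `Q` for every integer `x` of `E`. At an archimedean place it is the whole
decomposition group: a real place is ramified exactly when it becomes complex. -/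
def inertiaGroup (F : Type*) {E : Type*} [Field F] [Field E] [Algebra F E] :
    Place E → Subgroup Gal(E/F)
  | finite Q => Q.asIdeal.toAddSubgroup.inertia Gal(E/F)
  | infinite w => MulAction.stabilizer Gal(E/F) w

end Place

/-! In the following predicates `E/F` is a Galois extension and `S`, `T` are sets of primes
of a subfield `k` of `F`. -/

/-- The Galois extension `E/F` is unramified outside the primes lying over `S`. -/
def UnramifiedOutside (k F E : Type*) [Field k] [Field F] [Field E] [Algebra k E] [Algebra F E]
    (S : Set (Place k)) : Prop :=
  ∀ w : Place E, (∀ v ∈ S, ¬ w.LiesOver v) → w.inertiaGroup F = ⊥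

/-- The Galois extension `E/F` is totally ramified at all primes lying over `S`. -/
def TotallyRamifiedOver (k F E : Type*) [Field k] [Field F] [Field E] [Algebra k E] [Algebra F E]
    (S : Set (Place k)) : Prop :=
  ∀ w : Place E, ∀ v ∈ S, w.LiesOver v → w.inertiaGroup F = ⊤

/-- The Galois extension `E/F` is totally decomposed at all primes lying over `T`. -/
def TotallyDecomposedOver (k F E : Type*) [Field k] [Field F] [Field E] [Algebra k E] [Algebra F E]
    (T : Set (Place k)) : Prop :=
  ∀ w : Place E, ∀ v ∈ T, w.LiesOver v → w.decompositionGroup F = ⊥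

/-- No prime in `T` splits in `E/k`: there is only one prime of `E` over each of them. -/
def NonSplit (k E : Type*) [Field k] [Field E] [Algebra k E] (T : Set (Place k)) : Prop :=
  ∀ v ∈ T, ∃! w : Place E, w.LiesOver v

/-- A (profinite) topological group is pro-`p` if its quotients by open normal subgroups
are `p`-groups. -/
def IsProP (p : ℕ) (G : Type*) [Group G] [TopologicalSpace G] : Prop :=
  ∀ U : OpenNormalSubgroup G, IsPGroup p (G ⧸ U.toSubgroup)

/-- `E/F` is an abelian pro-`p`-extension, unramified outside `S` and totally decomposed at all
primes over `T`, and the exponent of its Galois group divides `p ^ e` (no condition if `e = ∞`). -/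
structure IsAdmissible (p : ℕ) (e : ℕ∞) {k : Type*} [Field k] (S T : Set (Place k))
    (F E : Type*) [Field F] [Field E] [Algebra k E] [Algebra F E] : Prop where
  abelian : IsAbelianGalois F E
  pro_p : IsProP p Gal(E/F)
  unramified : UnramifiedOutside k F E S
  decomposed : TotallyDecomposedOver k F E T
  exponent : ∀ n : ℕ, e = n → ∀ σ : Gal(E/F), σ ^ p ^ n = 1

section

variable (p : ℕ) (e : ℕ∞) {k : Type*} [Field k] (S T : Set (Place k))
  (F Ω : Type*) [Field F] [Field Ω] [Algebra k F] [Algebra F Ω] [Algebra k Ω] [IsScalarTower k F Ω]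

/-- The field `L_{S,e}^T(F)` inside `Ω` (an algebraic closure of `F`): the maximal extension
of `F` that is admissible for `S`, `T`, `e`, as the compositum of all of them. -/
def maxExt : IntermediateField F Ω :=
  sSup {M : IntermediateField F Ω | IsAdmissible p e S T F M}

instance normal_maxExt : Normal F (maxExt p e S T F Ω) := by
  unfold maxExt
  rw [sSup_eq_iSup']
  have (M : {M : IntermediateField F Ω | IsAdmissible p e S T F M}) : Normal F M.1 := by
    have := M.2.abelian
    infer_instance
  exact IntermediateField.normal_iSup F Ω _

/-- The group `A_{S,e}^T(F) = Gal(L_{S,e}^T(F)/F)`, with its Krull topology. -/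
abbrev A : Type _ := Gal(maxExt p e S T F Ω/F)

end

section

variable {F F' Ω : Type*} [Field F] [Field F'] [Field Ω] [Algebra F F'] [Algebra F Ω]
  [Algebra F' Ω] [IsScalarTower F F' Ω]

/-- For `F ⊆ F' ⊆ Ω`, a normal extension `L/F` and an extension `L'/F'` with `L ⊆ L' ⊆ Ω`: the
restriction homomorphism `Gal(L'/F') → Gal(L/F)`. -/
noncomputable def restriction {L : IntermediateField F Ω} [Normal F L]
    {L' : IntermediateField F' Ω} (h : (L : Set Ω) ⊆ L') : Gal(L'/F') →* Gal(L/F) :=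
  letI incl : L →+* L' :=
    (algebraMap L Ω).codRestrict L'.toSubfield.toSubring (fun x => h x.2)
  letI : Algebra L L' := incl.toAlgebra
  haveI : IsScalarTower F L L' := IsScalarTower.of_algebraMap_eq fun x => by
    apply Subtype.ext
    rfl
  (AlgEquiv.restrictNormalHom L).comp (AlgEquiv.restrictScalarsHom F)

theorem coe_restriction_apply {L : IntermediateField F Ω} [Normal F L]
    {L' : IntermediateField F' Ω} (h : (L : Set Ω) ⊆ L') (σ : Gal(L'/F')) (x : L) :
    (restriction h σ x : Ω) = σ ⟨x, h x.2⟩ := by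
  let incl : L →+* L' :=
    (algebraMap L Ω).codRestrict L'.toSubfield.toSubring (fun x => h x.2)
  let : Algebra L L' := incl.toAlgebra
  have : IsScalarTower F L L' := IsScalarTower.of_algebraMap_eq fun x => by
    apply Subtype.ext
    rfl
  exact congrArg (fun y : L' => (y : Ω))
    (AlgEquiv.restrictNormal_commutes (AlgEquiv.restrictScalarsHom F σ : Gal(L'/F)) L x)

end

end ClassStability

/-!
All fields are compared inside the absolute Galois group `G = Gal(Ω/K)`. The key point is that
`IsAdmissible` can be tested on single elements of `Ω` (`isAdmissible_iff`), in terms of the inertia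
and decomposition groups in `G` of the primes of `Ω`; this rests on the surjectivity of inertia and
decomposition groups under restriction in infinite Galois extensions. In particular `L_{S,e}^T(F)`
consists of the admissible elements (`mem_maxExt_iff`), and the inclusions are immediate.

Let `X ≤ G'` be the subgroups of `G` fixing `K''` and `K'`. The inertia groups over
`Sigma \ (S ∪ T)`, because of total ramification, and the decomposition groups over `T`, because a
proper subgroup of the cyclic group `Gal(K''/K)` fixes `K'`, surject onto `Gal(K''/K)`, while they
are trivial on `L_{S,e}^T(K)`. By hypothesis there is at least one such group, so `K''` and
`L_{S,e}^T(K)` are linearly disjoint over `K`, whence all surjectivity statements.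

For injectivity let `T₀` be `T` or `Sigma ∩ T`, let `R` be the subgroup fixing `L_{S,e}^{T₀}(K'')`,
let `H₀` and `H₁` be those fixing `L_{S,e}^T(K)` and `L_{S,e}^T(K')`, and put `Y = H₀ ⊓ X`.
Injectivity of the restriction `A(K') → A(K)` gives `Y ≤ H₁`, and the claim is `Y ≤ R`. Otherwise,
as `G / R` is a pro-`p` group, there is a closed normal subgroup `Z` of `G` with `R ≤ Z < Y` such
that `Y / Z` is central and killed by `p`. One of the above local groups meets `X` inside `R`, so it
provides an element `σ` whose image generates `Gal(K''/K)` and with `σ ^ (p ^ 2)` in `R`. Passing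
from `σ` to `σ ^ p` replaces commutators and correction factors in `Y` by their `p`-th powers, which
vanish modulo `Z`; so the fixed field of `⟨σ ^ p⟩ Z` is an admissible extension of `K'`, and
`H₁ ≤ ⟨σ ^ p⟩ Z`. It follows that `Y ≤ ⟨σ ^ p⟩ Z ⊓ X = Z`, a contradiction. This is
`inf_ker_le_of_forall_closed`, applied in `fixingSubgroup_inf_le`. The primes of `T` outside `T₀`
are unramified in `L_{S,e}^{T₀}(K'')/K`, and their decomposition groups are procyclic there
(`exists_decompositionGroup_le_zpowers_sup`), which suffices for the argument.
-/

namespace ClassStability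

open scoped commutatorElement

/-! ### The group-theoretic core -/

/-- A nontrivial normal subgroup `Y` of a finite `p`-group `P` has a proper subgroup `Z`, normal in
`P`, such that `Y / Z` is central in `P / Z` and killed by `p`: take the subgroup generated by the
commutators `[P, Y]` and the `p`-th powers of elements of `Y`. -/
theorem exists_normal_lt_of_isPGroup {p : ℕ} [Fact p.Prime] {P : Type*} [Group P] [Finite P]
    (hP : IsPGroup p P) (Y : Subgroup P) [Y.Normal] (hY : Y ≠ ⊥) :
    ∃ Z : Subgroup P, Z.Normal ∧ Z < Y ∧ (∀ g : P, ∀ y ∈ Y, ⁅g, y⁆ ∈ Z) ∧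
      ∀ y ∈ Y, y ^ p ∈ Z := by
  classical
  have hnil : Group.IsNilpotent P := hP.isNilpotent
  have hle : ⁅Y, (⊤ : Subgroup P)⁆ ≤ Y := Subgroup.commutator_le_left Y ⊤
  have hlt : ⁅Y, (⊤ : Subgroup P)⁆ < Y := by
    refine lt_of_le_of_ne hle fun h => hY ?_
    obtain ⟨n, hn⟩ := Subgroup.nilpotent_iff_lowerCentralSeries.1 hnil
    have key : ∀ n, Y ≤ Subgroup.lowerCentralSeries (⊤ : Subgroup P) n := by
      intro n
      induction n with
      | zero => simp
      | succ n ih =>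
        rw [← h]
        exact Subgroup.commutator_mono ih le_top
    exact le_bot_iff.1 (hn ▸ key n)
  set Z₁ := ⁅Y, (⊤ : Subgroup P)⁆ with hZ₁
  have hcen : ∀ g : P, ∀ y ∈ Y, ⁅g, y⁆ ∈ Z₁ := fun g y hy => by
    rw [hZ₁, Subgroup.commutator_comm]
    exact Subgroup.commutator_mem_commutator (Subgroup.mem_top g) hy
  let q := QuotientGroup.mk' Z₁
  have hqc : ∀ y ∈ Y, ∀ g : P, q g * q y = q y * q g := fun y hy g => by
    have h : q ⁅g, y⁆ = 1 := (QuotientGroup.eq_one_iff _).2 (hcen g y hy)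
    rw [map_commutatorElement] at h
    exact commutatorElement_eq_one_iff_mul_comm.1 h
  -- the `p`-th powers, modulo the commutators
  let Z : Subgroup P :=
    { carrier := {z | ∃ y ∈ Y, q z = q y ^ p}
      one_mem' := ⟨1, Y.one_mem, by simp⟩
      mul_mem' := by
        rintro a b ⟨y, hy, ha⟩ ⟨y', hy', hb⟩
        refine ⟨y * y', Y.mul_mem hy hy', ?_⟩
        rw [map_mul, ha, hb, map_mul]
        exact ((show Commute (q y) (q y') from hqc y' hy' y).mul_pow p).symm
      inv_mem' := by
        rintro a ⟨y, hy, ha⟩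
        exact ⟨y⁻¹, Y.inv_mem hy, by rw [map_inv, ha, map_inv, inv_pow]⟩ }
  have hZ₁Z : Z₁ ≤ Z := fun z hz =>
    ⟨1, Y.one_mem, by
      rw [map_one, one_pow]; exact (QuotientGroup.eq_one_iff z).2 hz⟩
  have hZY : Z ≤ Y := by
    rintro z ⟨y, hy, hz⟩
    rw [← map_pow] at hz
    have : (y ^ p)⁻¹ * z ∈ Z₁ := QuotientGroup.eq.1 hz.symm
    simpa using Y.mul_mem (Y.pow_mem hy p) (hle this)
  refine ⟨Z, ⟨fun z hz g => ?_⟩, lt_of_le_of_ne hZY fun h => ?_,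
    fun g y hy => hZ₁Z (hcen g y hy), fun y hy => ⟨y, hy, by simp⟩⟩
  · have := Z.mul_mem (hZ₁Z (hcen g z (hZY hz))) hz
    rwa [commutatorElement_def, inv_mul_cancel_right] at this
  · -- `y ↦ y ^ p` would be onto on the finite group `q(Y)`, contradicting Cauchy's theorem
    let B := Y.map q
    have hB : IsPGroup p B := (hP.of_surjective q (QuotientGroup.mk'_surjective _)).to_subgroup B
    have hsurj : Function.Surjective (fun b : B => b ^ p) := by
      rintro ⟨_, y, hy, rfl⟩
      have hy' : y ∈ Z := h ▸ hy
      obtain ⟨y', hy', e⟩ := hy'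
      exact ⟨⟨q y', y', hy', rfl⟩, Subtype.ext e.symm⟩
    have hinj := Finite.injective_iff_surjective.2 hsurj
    have hB1 : ∀ b : B, b = 1 := by
      intro b
      obtain ⟨n, hn⟩ := hB b
      induction n generalizing b with
      | zero => simpa using hn
      | succ n ih =>
        have : b ^ p = 1 := ih (b ^ p) (by rwa [← pow_mul, ← pow_succ'])
        exact hinj (by simpa using this)
    refine hlt.not_ge fun y hy => ?_
    have := congrArg Subtype.val (hB1 ⟨q y, y, hy, rfl⟩)
    exact (QuotientGroup.eq_one_iff y).1 this

theorem pow_mul_of_central {Q : Type*} [Group Q] {s x c : Q} (hc : ∀ g, c * g = g * c)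
    (h : s * x = c * x * s) (n : ℕ) : s ^ n * x = c ^ n * x * s ^ n := by
  induction n with
  | zero => simp
  | succ n ih =>
    have hcn : c * s ^ n = s ^ n * c := hc _
    calc s ^ (n + 1) * x = s * (s ^ n * x) := by rw [pow_succ', mul_assoc]
      _ = s * (c ^ n * x * s ^ n) := by rw [ih]
      _ = c ^ n * (s * x) * s ^ n := by
        rw [← mul_assoc, ← mul_assoc,
          ((show Commute c s from hc s).pow_left n).eq.symm, mul_assoc (c ^ n)]
      _ = c ^ (n + 1) * x * s ^ (n + 1) := by
        rw [h, pow_succ, pow_succ']; simp only [mul_assoc]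

/-- Let `X` be the kernel of a homomorphism `χ` from a profinite group `G` onto a cyclic group of
order `p ^ 2`, and `G' = {g | χ g ^ p = 1}`. In the application `G` is an absolute Galois group,
`R`, `H₀`, `H₁` are the subgroups fixing `L(K'')`, `L(K)`, `L(K')`, and `𝒥` consists of inertia and
decomposition groups; `hmax` expresses the maximality of `L(K')`.

If `Y = H₀ ⊓ X` were not contained in `R`, there would be `Z` with `R ≤ Z < Y` and `Y / Z` central
and killed by `p`. Then `[σ ^ p, x] = [σ, x] ^ p` and `(y σ ^ k) ^ p = σ ^ (k p)` modulo `Z` for `x`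
in `X`, `y` in `Y` and a suitable `σ` in `J₀`, so that `W = ⟨σ ^ p⟩ Z` contains all that `hmax` asks
for. Hence `H₁ ≤ W`, and `Y ≤ W ⊓ X = Z`. -/
theorem inf_ker_le_of_forall_closed {G C : Type*} [Group G] [TopologicalSpace G]
    [IsTopologicalGroup G] [CompactSpace G] [TotallyDisconnectedSpace G] [Group C]
    {p : ℕ} [hp : Fact p.Prime] (hC : Nat.card C = p ^ 2) [IsCyclic C] (χ : G →* C)
    (hX : IsOpen (χ.ker : Set G)) (R H₀ H₁ : Subgroup G) [R.Normal] [H₀.Normal]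
    (hRc : IsClosed (R : Set G)) (hH₀ : IsClosed (H₀ : Set G))
    (hRX : R ≤ χ.ker) (hRH : R ≤ H₀)
    (hab : ∀ x ∈ χ.ker, ∀ y ∈ χ.ker, ⁅x, y⁆ ∈ R)
    (hpro : ∀ x ∈ χ.ker, ∀ O : Subgroup G, IsOpen (O : Set G) → R ≤ O → ∃ n : ℕ, x ^ p ^ n ∈ O)
    (hcomm : ∀ g h : G, ⁅g, h⁆ ∈ H₀)
    (N : Set ℕ) (hN : ∀ m ∈ N, ∀ x ∈ χ.ker, x ^ m ∈ R)
    (𝒥 : Set (Subgroup G)) (hJH : ∀ J ∈ 𝒥, J ≤ H₀) (hJC : ∀ J ∈ 𝒥, J.map χ = ⊤)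
    (hJcyc : ∀ J ∈ 𝒥, ∀ V : Subgroup G, V.Normal → IsOpen (V : Set G) → R ≤ V →
      ∃ δ ∈ J, J ≤ Subgroup.zpowers δ ⊔ V)
    (J₀ : Subgroup G) (hJ₀ : J₀ ∈ 𝒥) (hJ₀R : J₀ ⊓ χ.ker ≤ R)
    (hmax : ∀ W : Subgroup G, IsClosed (W : Set G) → R ≤ W →
      (∀ g h : G, χ g ^ p = 1 → χ h ^ p = 1 → ⁅g, h⁆ ∈ W) →
      (∀ m ∈ N, ∀ g : G, χ g ^ p = 1 → g ^ m ∈ W) →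
      (∀ J ∈ 𝒥, ∀ g ∈ J, χ g ^ p = 1 → g ∈ W) → H₁ ≤ W)
    (hH : H₀ ⊓ χ.ker ≤ H₁) : H₀ ⊓ χ.ker ≤ R := by
  by_contra hnot
  obtain ⟨y₀, hy₀, hy₀R⟩ := Set.not_subset.1 hnot
  set Y := H₀ ⊓ χ.ker with hY
  have hYn : Y.Normal := inferInstance
  have hYc : IsClosed (Y : Set G) := hH₀.inter (Subgroup.isClosed_of_isOpen _ hX)
  have hRY : R ≤ Y := le_inf hRH hRX
  have hp0 : p ≠ 0 := hp.out.ne_zero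
  -- an open normal subgroup `V ⊆ X` containing `R` but not `y₀`
  obtain ⟨V, hVn, hVo, hRV, hVX, hy₀V⟩ : ∃ V : Subgroup G, V.Normal ∧ IsOpen (V : Set G) ∧
      R ≤ V ∧ V ≤ χ.ker ∧ y₀ ∉ V := by
    have ho : IsOpen ((fun g => y₀ * g) ⁻¹' (R : Set G)ᶜ) :=
      hRc.isOpen_compl.preimage (continuous_const_mul y₀)
    obtain ⟨V₀, hV₀⟩ := ProfiniteGrp.exist_openNormalSubgroup_sub_open_nhds_of_one ho
      (by simpa using hy₀R)
    refine ⟨(R ⊔ V₀.toSubgroup) ⊓ χ.ker, inferInstance, ?_, le_inf le_sup_left hRX, inf_le_right,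
      fun h => ?_⟩
    · exact (Subgroup.isOpen_mono (le_sup_right : V₀.toSubgroup ≤ R ⊔ V₀.toSubgroup)
        V₀.isOpen').inter hX
    · obtain ⟨r, hr, v, hv, e⟩ := Subgroup.mem_sup_of_normal_left.1 h.1
      have : v⁻¹ ∈ (V₀ : Set G) := V₀.toSubgroup.inv_mem hv
      refine hV₀ this ?_
      simpa [← e] using hr
  have hfin : Finite (G ⧸ V) := Subgroup.quotient_finite_of_isOpen V hVo
  have hChi : ∀ g, χ g ^ p ^ 2 = 1 := fun g => hC ▸ pow_card_eq_one'
  have hPG : IsPGroup p (G ⧸ V) := by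
    intro g
    obtain ⟨g, rfl⟩ := QuotientGroup.mk_surjective g
    obtain ⟨n, hn⟩ := hpro (g ^ p ^ 2) (by simpa using hChi g) V hVo hRV
    refine ⟨2 + n, ?_⟩
    rw [pow_add, pow_mul, ← QuotientGroup.mk_pow, ← QuotientGroup.mk_pow]
    exact (QuotientGroup.eq_one_iff _).2 hn
  have : (Y.map (QuotientGroup.mk' V)).Normal :=
    hYn.map _ (QuotientGroup.mk'_surjective V)
  obtain ⟨Z', hZ'n, hZ'lt, hZ'c, hZ'p⟩ := exists_normal_lt_of_isPGroup hPG
    (Y.map (QuotientGroup.mk' V)) (by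
      intro h
      have := (Subgroup.eq_bot_iff_forall _).1 h _ (Subgroup.mem_map_of_mem _ hy₀)
      exact hy₀V ((QuotientGroup.eq_one_iff _).1 this))
  set Z := Y ⊓ Z'.comap (QuotientGroup.mk' V) with hZ
  have hZn : Z.Normal := inferInstance
  have hVZ' : V ≤ Z'.comap (QuotientGroup.mk' V) := fun v hv => by
    have : QuotientGroup.mk' V v = 1 := (QuotientGroup.eq_one_iff v).2 hv
    rw [Subgroup.mem_comap, this]; exact Z'.one_mem
  have hZc : IsClosed (Z : Set G) :=
    hYc.inter (Subgroup.isClosed_of_isOpen _ (Subgroup.isOpen_mono hVZ' hVo))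
  have hRZ : R ≤ Z := le_inf hRY (hRV.trans hVZ')
  have hYZ : ¬ Y ≤ Z := fun h => hZ'lt.not_ge <| by
    rintro _ ⟨y, hy, rfl⟩
    exact (h hy).2
  have hZcomm : ∀ g, ∀ y ∈ Y, ⁅g, y⁆ ∈ Z := fun g y hy => by
    refine ⟨?_, ?_⟩
    · rw [commutatorElement_def]
      exact Y.mul_mem (hYn.conj_mem y hy g) (Y.inv_mem hy)
    · change QuotientGroup.mk' V ⁅g, y⁆ ∈ Z'
      rw [map_commutatorElement]
      exact hZ'c _ _ (Subgroup.mem_map_of_mem _ hy)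
  have hZpow : ∀ y ∈ Y, y ^ p ∈ Z := fun y hy =>
    ⟨Y.pow_mem hy p, by
      change QuotientGroup.mk' V (y ^ p) ∈ Z'
      rw [map_pow]
      exact hZ'p _ (Subgroup.mem_map_of_mem _ hy)⟩
  -- compute in `G ⧸ Z`, where the image of `Y` is central and killed by `p`
  let q := QuotientGroup.mk' Z
  have hq1 : ∀ g, q g = 1 ↔ g ∈ Z := fun g => QuotientGroup.eq_one_iff g
  have hqcomm : ∀ g h, ⁅g, h⁆ ∈ Z → q g * q h = q h * q g := fun g h hgh => by
    have := (hq1 _).2 hgh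
    rw [map_commutatorElement] at this
    exact commutatorElement_eq_one_iff_mul_comm.1 this
  obtain ⟨c, hc⟩ := IsCyclic.exists_generator (α := C)
  obtain ⟨σ, hσJ, hσ⟩ : c ∈ J₀.map χ := hJC J₀ hJ₀ ▸ Subgroup.mem_top c
  have hord : ∀ c : C, (∀ x, x ∈ Subgroup.zpowers c) → ∀ k : ℤ, (c ^ k) ^ p = 1 →
      ∃ i : ℤ, k = p * i := by
    intro c hc k hk
    rw [← zpow_natCast, ← zpow_mul] at hk
    have h1 := orderOf_dvd_iff_zpow_eq_one.2 hk
    rw [orderOf_eq_card_of_forall_mem_zpowers hc, hC, pow_two] at h1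
    push_cast at h1
    exact Int.dvd_of_mul_dvd_mul_right (by exact_mod_cast hp0) h1
  have hσR : ∀ k : ℤ, χ (σ ^ k) = 1 → σ ^ k ∈ Z := fun k hk =>
    hRZ (hJ₀R ⟨J₀.zpow_mem hσJ k, hk⟩)
  have hdecomp : ∀ g, ∃ k : ℤ, c ^ k = χ g ∧ g * σ ^ (-k) ∈ χ.ker := fun g => by
    obtain ⟨k, hk⟩ := Subgroup.mem_zpowers_iff.1 (hc (χ g))
    exact ⟨k, hk, by simp [MonoidHom.mem_ker, hσ, hk]⟩
  set s := q σ with hs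
  have hsX : ∀ x ∈ χ.ker, s ^ p * q x = q x * s ^ p := by
    intro x hx
    have hcY : ⁅σ, x⁆ ∈ Y := ⟨hcomm σ x, by
      rw [commutatorElement_def]
      exact χ.ker.mul_mem ((inferInstance : χ.ker.Normal).conj_mem x hx σ) (χ.ker.inv_mem hx)⟩
    have hcp : q ⁅σ, x⁆ ^ p = 1 := by rw [← map_pow]; exact (hq1 _).2 (hZpow _ hcY)
    have := pow_mul_of_central (s := s) (x := q x) (c := q ⁅σ, x⁆) (fun g => by
        obtain ⟨g, rfl⟩ := QuotientGroup.mk'_surjective Z g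
        exact (hqcomm g _ (hZcomm g _ hcY)).symm)
      (by rw [hs, ← map_mul, ← map_mul, ← map_mul, commutatorElement_def]; congr 1; group) p
    rwa [hcp, one_mul] at this
  have hXX : ∀ x ∈ χ.ker, ∀ y ∈ χ.ker, q x * q y = q y * q x := fun x hx y hy =>
    hqcomm x y (hRZ (hab x hx y hy))
  -- modulo `Z`, the subgroup `G'` consists of the products `x * σ ^ (p * i)` with `x` in `X`
  have hG' : ∀ g, χ g ^ p = 1 → ∃ x ∈ χ.ker, ∃ i : ℤ, q g = q x * (s ^ p) ^ i := by
    intro g hg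
    obtain ⟨k, hk, hx⟩ := hdecomp g
    obtain ⟨i, rfl⟩ := hord c hc k (by rw [hk, hg])
    refine ⟨_, hx, i, ?_⟩
    rw [← zpow_natCast, ← zpow_mul, hs, ← map_zpow, ← map_mul]
    congr 1
    group
  -- the preimage `W = ⟨σ ^ p⟩ Z` satisfies the hypotheses of `hmax`
  let W : Subgroup G := (Subgroup.zpowers (s ^ p)).comap q
  have hWle : H₁ ≤ W := by
    refine hmax W ?_ ?_ ?_ ?_ ?_
    · have hfin : (Subgroup.zpowers (s ^ p) : Set (G ⧸ Z)).Finite := by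
        have : IsOfFinOrder (s ^ p) := by
          refine isOfFinOrder_iff_pow_eq_one.2 ⟨p, hp.out.pos, ?_⟩
          rw [← pow_mul, ← pow_two, hs, ← map_pow]
          refine (hq1 _).2 ?_
          have := hσR (p ^ 2 : ℕ) (by rw [zpow_natCast, map_pow, hChi])
          rwa [zpow_natCast] at this
        exact this.finite_zpowers
      have : IsClosed (Z : Set G) := hZc
      have : T1Space (G ⧸ Z) := inferInstance
      exact hfin.isClosed.preimage QuotientGroup.continuous_mk
    · intro r hr
      change q r ∈ Subgroup.zpowers (s ^ p)
      rw [(hq1 r).2 (hRZ hr)]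
      exact Subgroup.one_mem _
    · intro g h hg hh
      obtain ⟨x, hx, i, ex⟩ := hG' g hg
      obtain ⟨y, hy, j, ey⟩ := hG' h hh
      have hcom : Commute (q g) (q h) := by
        rw [ex, ey]
        have h1 : Commute (q x) (q y) := hXX x hx y hy
        have h2 : Commute (s ^ p) (q x) := hsX x hx
        have h3 : Commute (s ^ p) (q y) := hsX y hy
        exact (h1.mul_right (h2.symm.zpow_right j)).mul_left
          ((h3.zpow_left i).mul_right ((Commute.refl (s ^ p)).zpow_zpow i j))
      change q ⁅g, h⁆ ∈ Subgroup.zpowers (s ^ p)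
      rw [map_commutatorElement, commutatorElement_eq_one_iff_mul_comm.2 hcom]
      exact Subgroup.one_mem _
    · intro m hm g hg
      obtain ⟨x, hx, i, ex⟩ := hG' g hg
      have h2 : Commute (q x) ((s ^ p) ^ i) :=
        (show Commute (s ^ p) (q x) from hsX x hx).symm.zpow_right i
      have hxm : q x ^ m = 1 := by rw [← map_pow]; exact (hq1 _).2 (hRZ (hN m hm x hx))
      change q (g ^ m) ∈ Subgroup.zpowers (s ^ p)
      rw [map_pow, ex, h2.mul_pow, hxm, one_mul]
      exact Subgroup.pow_mem _ (Subgroup.zpow_mem _ (Subgroup.mem_zpowers _) _) _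
    · intro J hJ d hd hdp
      obtain ⟨δ, hδJ, hδ⟩ := hJcyc J hJ V hVn hVo hRV
      have hdec : ∀ d ∈ J, ∃ j : ℤ, ∃ v ∈ V, d = δ ^ j * v := fun d hd => by
        obtain ⟨a, ha, v, hv, e⟩ := Subgroup.mem_sup_of_normal_right.1 (hδ hd)
        obtain ⟨j, rfl⟩ := Subgroup.mem_zpowers_iff.1 ha
        exact ⟨j, v, hv, e.symm⟩
      have hgen : ∀ x, x ∈ Subgroup.zpowers (χ δ) := fun x => by
        obtain ⟨d, hd, rfl⟩ : x ∈ J.map χ := hJC J hJ ▸ Subgroup.mem_top x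
        obtain ⟨j, v, hv, rfl⟩ := hdec d hd
        exact ⟨j, by simp [show χ v = 1 from hVX hv]⟩
      obtain ⟨j, v, hv, rfl⟩ := hdec d hd
      have hvZ : q v = 1 := by
        refine (hq1 v).2 ⟨⟨hJH J hJ ?_, hVX hv⟩, hVZ' hv⟩
        have := J.mul_mem (J.inv_mem (J.zpow_mem hδJ j)) hd
        rwa [inv_mul_cancel_left] at this
      obtain ⟨i, rfl⟩ := hord _ hgen j (by
        rw [map_mul, show χ v = 1 from hVX hv, mul_one, map_zpow] at hdp
        exact hdp)
      obtain ⟨k, hk, hy⟩ := hdecomp δ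
      have hyY : δ * σ ^ (-k) ∈ Y :=
        ⟨H₀.mul_mem (hJH J hJ hδJ) (H₀.zpow_mem (hJH J₀ hJ₀ hσJ) _), hy⟩
      have e1 : q δ = q (δ * σ ^ (-k)) * s ^ k := by
        rw [hs, ← map_zpow, ← map_mul]; congr 1; group
      have e2 : q δ ^ p = (s ^ p) ^ k := by
        have hcom : Commute (q (δ * σ ^ (-k))) (s ^ k) :=
          (show Commute s (q (δ * σ ^ (-k))) from
            hqcomm σ _ (hZcomm σ _ hyY)).symm.zpow_right k
        rw [e1, hcom.mul_pow, ← map_pow, (hq1 _).2 (hZpow _ hyY), one_mul,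
          ← zpow_natCast, ← zpow_natCast, ← zpow_mul, ← zpow_mul, mul_comm]
      change q (δ ^ ((p : ℤ) * i) * v) ∈ Subgroup.zpowers (s ^ p)
      rw [map_mul, hvZ, mul_one, map_zpow, zpow_mul, zpow_natCast, e2]
      exact Subgroup.zpow_mem _ (Subgroup.zpow_mem _ (Subgroup.mem_zpowers _) _) _
  refine hYZ fun y hy => ?_
  obtain ⟨i, hi⟩ := Subgroup.mem_zpowers_iff.1 (show q y ∈ _ from hWle (hH hy))
  have hy1 : χ y = 1 := hy.2
  have hyσ : (σ ^ ((p : ℤ) * i))⁻¹ * y ∈ Z := by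
    refine QuotientGroup.eq.1 (show q _ = q y from ?_)
    rw [← hi, map_zpow, zpow_mul, zpow_natCast]
  have hmem : σ ^ ((p : ℤ) * i) ∈ Z := by
    refine hσR _ ?_
    have h1 : χ ((σ ^ ((p : ℤ) * i))⁻¹ * y) = 1 := hyσ.1.2
    rw [map_mul, hy1, mul_one, map_inv, inv_eq_one] at h1
    exact h1
  simpa using Z.mul_mem hmem hyσ

/-! ### Primes in towers and their decomposition and inertia groups -/

namespace Place

open NumberField

section

variable {F E L : Type*} [Field F] [Field E] [Field L]

/-- The prime `v` of `F` is the pull-back of the prime `w` of `E` along the field embedding `f`. This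
covers the relation `LiesOver` (`f = algebraMap F E`), the action of automorphisms on primes, and
the decomposition groups (`mem_decompositionGroup_iff`). -/
def IsComap (f : F →+* E) : Place E → Place F → Prop
  | finite Q, finite P => Q.asIdeal.comap (RingOfIntegers.mapRingHom f) = P.asIdeal
  | infinite w, infinite v => w.comap f = v
  | _, _ => False

/-- The endomorphism `f` of `E` satisfies the condition defining the inertia group of `w`. -/
def IsInertial (f : E →+* E) : Place E → Prop
  | finite Q => ∀ x, RingOfIntegers.mapRingHom f x - x ∈ Q.asIdeal
  | infinite w => w.comap f = w

theorem liesOver_iff [Algebra F E] {w : Place E} {v : Place F} :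
    w.LiesOver v ↔ IsComap (algebraMap F E) w v := by
  cases w <;> cases v <;> rfl

theorem IsComap.comp {f : F →+* E} {g : E →+* L} {w : Place L} {u : Place E} {v : Place F}
    (h : IsComap g w u) (h' : IsComap f u v) : IsComap (g.comp f) w v := by
  cases w <;> cases u <;> cases v <;> simp only [IsComap] at h h' ⊢
  · rw [← h', ← h]; rfl
  · rw [← h', ← h]; rfl

theorem IsComap.of_comp {f : F →+* E} {g : E →+* L} {w : Place L} {u : Place E} {v : Place F}
    (h : IsComap g w u) (h' : IsComap (g.comp f) w v) : IsComap f u v := by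
  cases w <;> cases u <;> cases v <;> simp only [IsComap] at h h' ⊢
  · rw [← h', ← h]; rfl
  · rw [← h', ← h]; rfl

theorem IsComap.unique {f : F →+* E} {w : Place E} {v v' : Place F}
    (h : IsComap f w v) (h' : IsComap f w v') : v = v' := by
  cases w <;> cases v <;> cases v' <;> simp only [IsComap] at h h'
  · exact congrArg _ (IsDedekindDomain.HeightOneSpectrum.ext (h.symm.trans h'))
  · exact congrArg _ (h.symm.trans h')

instance [Algebra F E] : Algebra.IsIntegral (𝓞 F) (𝓞 E) :=
  ⟨fun x => (RingOfIntegers.isIntegral x).tower_top⟩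

theorem exists_isComap (f : F →+* E) (w : Place E) : ∃ v : Place F, IsComap f w v := by
  cases w with
  | finite Q =>
    let := f.toAlgebra
    exact ⟨finite ⟨Q.asIdeal.comap (RingOfIntegers.mapRingHom f), inferInstance,
      Ideal.IsIntegral.comap_ne_bot (R := 𝓞 F) Q.ne_bot⟩, rfl⟩
  | infinite w => exact ⟨infinite (w.comap f), rfl⟩

variable (F) in
theorem exists_liesOver [Algebra F E] (w : Place E) : ∃ v : Place F, w.LiesOver v := by
  simpa only [liesOver_iff] using exists_isComap (algebraMap F E) w

variable (E) in
theorem exists_liesOver_of_isAlgebraic [Algebra F E] [Algebra.IsAlgebraic F E] (v : Place F) :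
    ∃ w : Place E, w.LiesOver v := by
  cases v with
  | finite P =>
    have hinj : Function.Injective (algebraMap (𝓞 F) (𝓞 E)) := fun x y h =>
      RingOfIntegers.ext ((algebraMap F E).injective (congrArg (algebraMap (𝓞 E) E) h))
    obtain ⟨Q, hQ, hQP⟩ := Ideal.exists_ideal_over_prime_of_isIntegral_of_isDomain (S := 𝓞 E)
      P.asIdeal (by rw [(RingHom.injective_iff_ker_eq_bot _).1 hinj]; exact bot_le)
    refine ⟨finite ⟨Q, hQ, ?_⟩, hQP⟩
    rintro rfl
    exact P.ne_bot (by rw [← hQP, ← RingHom.ker_eq_comap_bot,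
      (RingHom.injective_iff_ker_eq_bot _).1 hinj])
  | infinite v =>
    obtain ⟨w, hw⟩ := InfinitePlace.comap_surjective (K := E) v
    exact ⟨infinite w, hw⟩

theorem LiesOver.unique [Algebra F E] {w : Place E} {v v' : Place F}
    (h : w.LiesOver v) (h' : w.LiesOver v') : v = v' :=
  (liesOver_iff.1 h).unique (liesOver_iff.1 h')

theorem LiesOver.trans [Algebra F E] [Algebra E L] [Algebra F L] [IsScalarTower F E L]
    {w : Place L} {u : Place E} {v : Place F} (h : w.LiesOver u) (h' : u.LiesOver v) :
    w.LiesOver v := by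
  rw [liesOver_iff] at *
  rw [IsScalarTower.algebraMap_eq F E L]
  exact h.comp h'

theorem LiesOver.of_tower [Algebra F E] [Algebra E L] [Algebra F L] [IsScalarTower F E L]
    {w : Place L} {u : Place E} {v : Place F} (h : w.LiesOver u) (h' : w.LiesOver v) :
    u.LiesOver v := by
  rw [liesOver_iff] at *
  rw [IsScalarTower.algebraMap_eq F E L] at h'
  exact h.of_comp h'

theorem mem_decompositionGroup_iff [Algebra F E] {w : Place E} {σ : Gal(E/F)} :
    σ ∈ w.decompositionGroup F ↔ IsComap (σ : E →+* E) w w := by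
  rw [← inv_mem_iff]
  cases w with
  | finite Q =>
    change σ⁻¹ • Q.asIdeal = Q.asIdeal ↔ _
    rw [Ideal.pointwise_smul_eq_comap]
    rfl
  | infinite w => exact Iff.rfl

theorem mem_inertiaGroup_iff [Algebra F E] {w : Place E} {σ : Gal(E/F)} :
    σ ∈ w.inertiaGroup F ↔ IsInertial (σ : E →+* E) w := by
  cases w with
  | finite Q => exact Iff.rfl
  | infinite w => exact mem_decompositionGroup_iff (w := infinite w)

theorem inertiaGroup_le_decompositionGroup [Algebra F E] (w : Place E) :
    w.inertiaGroup F ≤ w.decompositionGroup F := by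
  cases w with
  | finite Q => exact Ideal.inertia_le_stabilizer Q.asIdeal
  | infinite w => exact le_rfl

theorem IsInertial.of_comp {f : E →+* L} {w : Place L} {u : Place E} (h : IsComap f w u)
    {τ : L →+* L} {σ : E →+* E} (hc : τ.comp f = f.comp σ) (hτ : IsInertial τ w) :
    IsInertial σ u := by
  cases w <;> cases u <;> simp only [IsComap, IsInertial] at h hτ ⊢
  · intro x
    rw [← h, Ideal.mem_comap, map_sub]
    have : RingOfIntegers.mapRingHom f (RingOfIntegers.mapRingHom σ x)
        = RingOfIntegers.mapRingHom τ (RingOfIntegers.mapRingHom f x) :=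
      RingOfIntegers.ext (RingHom.congr_fun hc x).symm
    rw [this]
    exact hτ _
  · rw [← h, ← InfinitePlace.comap_comp, ← hc, InfinitePlace.comap_comp, hτ]

theorem IsComap.of_comp_eq {f : E →+* L} {w : Place L} {u : Place E} (h : IsComap f w u)
    {τ : L →+* L} {σ : E →+* E} (hc : τ.comp f = f.comp σ) (hτ : IsComap τ w w) :
    IsComap σ u u :=
  h.of_comp (hc ▸ hτ.comp h)

end

theorem smulCommClass_ringOfIntegers {F E : Type*} [Field F] [Field E] [Algebra F E] :
    SMulCommClass Gal(E/F) (𝓞 F) (𝓞 E) := by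
  refine ⟨fun σ a b => RingOfIntegers.ext ?_⟩
  rw [Algebra.smul_def, Algebra.smul_def, smul_mul']
  change σ (algebraMap F E a) * _ = _
  rw [AlgEquiv.commutes]
  rfl

theorem continuousSMul_ringOfIntegers {F E : Type*} [Field F] [Field E] [Algebra F E]
    [Algebra.IsAlgebraic F E] :
    letI : TopologicalSpace (𝓞 E) := ⊥
    ContinuousSMul Gal(E/F) (𝓞 E) := by
  let : TopologicalSpace (𝓞 E) := ⊥
  have : DiscreteTopology (𝓞 E) := ⟨rfl⟩
  refine continuousSMul_iff_stabilizer_isOpen.2 fun x => ?_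
  have : (MulAction.stabilizer Gal(E/F) x : Set Gal(E/F)) =
      MulAction.stabilizer Gal(E/F) (x : E) :=
    Set.ext fun σ => ⟨fun h => congrArg (algebraMap (𝓞 E) E) h, fun h => RingOfIntegers.ext h⟩
  rw [this]
  exact stabilizer_isOpen_of_isIntegral _

section

variable {F E : Type*} [Field F] [Field E] [Algebra F E] [IsGalois F E]

theorem isInvariant_ringOfIntegers : Algebra.IsInvariant (𝓞 F) (𝓞 E) Gal(E/F) := by
  refine ⟨fun b hb => ?_⟩
  obtain ⟨a, ha⟩ := (InfiniteGalois.mem_range_algebraMap_iff_fixed (k := F) (b : E)).2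
    fun σ => congrArg (algebraMap (𝓞 E) E) (hb σ)
  have hint : IsIntegral ℤ a := by
    have : IsIntegral ℤ (b : E) := RingOfIntegers.isIntegral_coe b
    rw [← ha] at this
    exact (isIntegral_algebraMap_iff (algebraMap F E).injective).1 this
  exact ⟨⟨a, hint⟩, RingOfIntegers.ext ha⟩

/-- The Galois group acts transitively on the primes over a given prime. -/
theorem exists_isComap_of_liesOver {w w' : Place E} {v : Place F} (h : w.LiesOver v)
    (h' : w'.LiesOver v) : ∃ σ : Gal(E/F), IsComap (σ : E →+* E) w w' := by
  cases w <;> cases w' <;> cases v <;> simp only [LiesOver] at h h'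
  · rename_i Q Q' P
    let : TopologicalSpace (𝓞 E) := ⊥
    have : DiscreteTopology (𝓞 E) := ⟨rfl⟩
    have := isInvariant_ringOfIntegers (F := F) (E := E)
    have := smulCommClass_ringOfIntegers (F := F) (E := E)
    have := continuousSMul_ringOfIntegers (F := F) (E := E)
    obtain ⟨σ, hσ⟩ := Algebra.IsInvariant.exists_smul_of_under_eq_of_profinite
      (A := 𝓞 F) (G := Gal(E/F)) Q.asIdeal Q'.asIdeal (h.trans h'.symm)
    refine ⟨σ⁻¹, ?_⟩
    rw [Ideal.pointwise_smul_eq_comap] at hσ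
    exact hσ.symm
  · rename_i w w' v
    obtain ⟨σ, hσ⟩ := InfinitePlace.exists_smul_eq_of_comap_eq (h.trans h'.symm)
    exact ⟨σ⁻¹, hσ⟩

end

section

variable {F E L : Type*} [Field F] [Field E] [Field L] [Algebra F E] [Algebra E L]
  [Algebra F L] [IsScalarTower F E L] [IsGalois F L] [Normal F E]

/-- Decomposition groups surject under restriction, by transitivity of `Gal(L/E)` on the primes
over `u`. -/
theorem exists_mem_decompositionGroup {w : Place L} {u : Place E} (h : w.LiesOver u)
    {σ : Gal(E/F)} (hσ : σ ∈ u.decompositionGroup F) :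
    ∃ τ ∈ w.decompositionGroup F, ∀ x, τ (algebraMap E L x) = algebraMap E L (σ x) := by
  have : IsGalois E L := IsGalois.tower_top_of_isGalois F E L
  obtain ⟨g, hg⟩ := AlgEquiv.restrictNormalHom_surjective (F := F) (K₁ := E) L σ
  have hgx : ∀ x, g (algebraMap E L x) = algebraMap E L (σ x) := fun x => by
    rw [← hg]; exact (AlgEquiv.restrictNormal_commutes g E x).symm
  obtain ⟨w', hw'⟩ := exists_isComap (g : L →+* L) w
  have hc : (g : L →+* L).comp (algebraMap E L) = (algebraMap E L).comp (σ : E →+* E) :=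
    RingHom.ext hgx
  rw [liesOver_iff] at h
  rw [mem_decompositionGroup_iff] at hσ
  have h' : w'.LiesOver u := liesOver_iff.2 (hw'.of_comp (hc ▸ h.comp hσ))
  obtain ⟨τ, hτ⟩ := exists_isComap_of_liesOver (F := E) h' (liesOver_iff.2 h)
  refine ⟨g * AlgEquiv.restrictScalarsHom F τ, mem_decompositionGroup_iff.2 (hw'.comp hτ),
    fun x => ?_⟩
  change g (τ _) = _
  rw [AlgEquiv.commutes, hgx]

/-- Inertia groups surject under restriction: a lift to the decomposition group is corrected by an
element of the decomposition group in `Gal(L/E)` inducing the same residue field automorphism. -/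
theorem exists_mem_inertiaGroup {w : Place L} {u : Place E} (h : w.LiesOver u)
    {σ : Gal(E/F)} (hσ : σ ∈ u.inertiaGroup F) :
    ∃ τ ∈ w.inertiaGroup F, ∀ x, τ (algebraMap E L x) = algebraMap E L (σ x) := by
  have : IsGalois E L := IsGalois.tower_top_of_isGalois F E L
  obtain ⟨g, hgw, hgx⟩ := exists_mem_decompositionGroup h
    (inertiaGroup_le_decompositionGroup u hσ)
  cases w with
  | infinite w => exact ⟨g, hgw, hgx⟩
  | finite Q =>
    cases u with
    | infinite u => exact h.elim
    | finite P =>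
    -- the automorphism of the residue field of `Q` induced by `g` is trivial on that of `P`
    let : TopologicalSpace (𝓞 L) := ⊥
    have : DiscreteTopology (𝓞 L) := ⟨rfl⟩
    have := isInvariant_ringOfIntegers (F := E) (E := L)
    have := smulCommClass_ringOfIntegers (F := E) (E := L)
    have := continuousSMul_ringOfIntegers (F := E) (E := L)
    have : Q.asIdeal.LiesOver P.asIdeal := ⟨h.symm⟩
    let g' : (𝓞 L ⧸ Q.asIdeal) ≃+* (𝓞 L ⧸ Q.asIdeal) :=
      Ideal.quotientEquiv Q.asIdeal Q.asIdeal (MulSemiringAction.toRingEquiv Gal(L/F) (𝓞 L) g)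
        (show Q.asIdeal = g • Q.asIdeal from hgw.symm)
    have hg' : ∀ a : 𝓞 E ⧸ P.asIdeal,
        g' (algebraMap _ _ a) = algebraMap (𝓞 E ⧸ P.asIdeal) (𝓞 L ⧸ Q.asIdeal) a := by
      intro a
      obtain ⟨a, rfl⟩ := Ideal.Quotient.mk_surjective a
      change Ideal.Quotient.mk Q.asIdeal (g • algebraMap (𝓞 E) (𝓞 L) a)
        = Ideal.Quotient.mk Q.asIdeal (algebraMap (𝓞 E) (𝓞 L) a)
      have e : g • algebraMap (𝓞 E) (𝓞 L) a = algebraMap (𝓞 E) (𝓞 L) (σ • a) :=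
        RingOfIntegers.ext (hgx a)
      rw [e, Ideal.Quotient.eq, ← map_sub, ← Ideal.mem_comap]
      have h' : Q.asIdeal.comap (algebraMap (𝓞 E) (𝓞 L)) = P.asIdeal := h
      rw [h']
      exact hσ a
    obtain ⟨τ, hτ⟩ := Ideal.Quotient.stabilizerHom_surjective_of_profinite (G := Gal(L/E))
      P.asIdeal Q.asIdeal (AlgEquiv.ofRingEquiv (f := g') hg')
    refine ⟨g * AlgEquiv.restrictScalarsHom F τ.1⁻¹, mem_inertiaGroup_iff.2 fun x => ?_,
      fun x => ?_⟩
    · have h1 := AlgEquiv.congr_fun hτ (Ideal.Quotient.mk _ (τ.1⁻¹ • x))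
      have h2 : Ideal.Quotient.mk Q.asIdeal (τ.1 • τ.1⁻¹ • x)
          = Ideal.Quotient.mk Q.asIdeal (g • τ.1⁻¹ • x) := h1
      rw [smul_inv_smul] at h2
      exact Ideal.Quotient.eq.1 h2.symm
    · change g (τ.1⁻¹ _) = _
      rw [AlgEquiv.commutes, hgx]

end

/-- A finite group of automorphisms of an algebraic extension of a finite field is cyclic, since it
acts faithfully already on some finite subextension. -/
theorem _root_.IsCyclic.of_injective_gal {k l G : Type*} [Field k] [Field l] [Algebra k l]
    [Finite k] [Algebra.IsAlgebraic k l] [Group G] [Finite G] (φ : G →* Gal(l/k))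
    (hφ : Function.Injective φ) : IsCyclic G := by
  have hx : ∀ g : G, ∃ x : l, φ g x = x → g = 1 := by
    intro g
    by_contra! h
    exact (h 0).2 (hφ ((AlgEquiv.ext fun x => (h x).1).trans (map_one φ).symm))
  choose x hx using hx
  let f := IntermediateField.adjoin k (Set.range x)
  have : FiniteDimensional k f := IntermediateField.finiteDimensional_adjoin
    fun x _ => Algebra.IsIntegral.isIntegral x
  have : Finite f := Module.finite_of_finite k
  refine isCyclic_of_injective ((AlgEquiv.restrictNormalHom (F := k) f).comp φ)
    ((injective_iff_map_eq_one _).2 fun g hg => hx g ?_)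
  have hmem : x g ∈ f := IntermediateField.subset_adjoin k _ ⟨g, rfl⟩
  have h1 := AlgEquiv.restrictNormal_commutes (φ g) f ⟨x g, hmem⟩
  have h2 : (φ g).restrictNormal f = 1 := hg
  rw [h2] at h1
  exact h1.symm

/-- A finite group of automorphisms fixing a nonarchimedean prime, with trivial inertia, is cyclic:
it acts faithfully on the residue field, which is algebraic over a finite field. -/
theorem isCyclic_of_inf_inertia_eq_bot {F E : Type*} [Field F] [Field E] [Algebra F E]
    (Q : IsDedekindDomain.HeightOneSpectrum (𝓞 E)) (H : Subgroup Gal(E/F)) [Finite H]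
    (hH : H ≤ (finite Q).decompositionGroup F)
    (hI : H ⊓ (finite Q).inertiaGroup F = ⊥) : IsCyclic H := by
  let P := Q.asIdeal.under ℤ
  have hP0 : P ≠ ⊥ := Ideal.IsIntegral.comap_ne_bot (R := ℤ) Q.ne_bot
  have hPm : P.IsMaximal := Ring.DimensionLEOne.maximalOfPrime hP0 inferInstance
  have hQm : Q.asIdeal.IsMaximal := Ideal.isMaximal_of_isIntegral_of_isMaximal_comap (R := ℤ) _ hPm
  let : Field (ℤ ⧸ P) := Ideal.Quotient.field P
  let : Field (𝓞 E ⧸ Q.asIdeal) := Ideal.Quotient.field Q.asIdeal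
  have : Finite (ℤ ⧸ P) := Ideal.finiteQuotientOfFreeOfNeBot P hP0
  have : Algebra.IsIntegral (ℤ ⧸ P) (𝓞 E ⧸ Q.asIdeal) := inferInstance
  let φ := (Ideal.Quotient.stabilizerHom Q.asIdeal P Gal(E/F)).comp (Subgroup.inclusion hH)
  refine IsCyclic.of_injective_gal (k := ℤ ⧸ P) (l := 𝓞 E ⧸ Q.asIdeal) φ
    ((injective_iff_map_eq_one _).2 fun g hg => ?_)
  have h1 : Subgroup.inclusion hH g ∈ (Ideal.Quotient.stabilizerHom Q.asIdeal P Gal(E/F)).ker := hg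
  rw [Ideal.Quotient.ker_stabilizerHom] at h1
  have h2 : g.1 ∈ H ⊓ (finite Q).inertiaGroup F := ⟨g.2, h1⟩
  rw [hI] at h2
  exact Subtype.ext h2

end Place

/-! ### Admissible extensions inside an algebraic closure -/

section

variable {k Ω : Type*} [Field k] [Field Ω] [Algebra k Ω]

variable (k Ω) in
/-- The subgroup of `Gal(Ω/k)` fixing the image of the field `F` in `Ω`. -/
def fieldStabilizer (F : Type*) [Field F] [Algebra F Ω] : Subgroup Gal(Ω/k) :=
  fixingSubgroup Gal(Ω/k) (Set.range (algebraMap F Ω))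

section

variable {F : Type*} [Field F] [Algebra F Ω]

theorem mem_fieldStabilizer {g : Gal(Ω/k)} :
    g ∈ fieldStabilizer k Ω F ↔ ∀ x : F, g (algebraMap F Ω x) = algebraMap F Ω x := by
  simp [fieldStabilizer, mem_fixingSubgroup_iff]

variable [Algebra k F] [IsScalarTower k F Ω]

theorem restrictScalars_mem_fieldStabilizer (g : Gal(Ω/F)) :
    AlgEquiv.restrictScalarsHom k g ∈ fieldStabilizer k Ω F :=
  mem_fieldStabilizer.2 fun x => g.commutes x

omit [Algebra k F] [IsScalarTower k F Ω] in
theorem exists_gal_of_mem_fieldStabilizer {g : Gal(Ω/k)} (hg : g ∈ fieldStabilizer k Ω F) :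
    ∃ g' : Gal(Ω/F), (g' : Ω →+* Ω) = g :=
  ⟨AlgEquiv.ofRingEquiv (f := (g : Ω ≃+* Ω)) (mem_fieldStabilizer.1 hg), rfl⟩

end

/-- On a finite subextension, the exponents in the elementwise pro-`p` condition can be chosen
uniformly. -/
theorem exists_pow_forall_mem {g : Gal(Ω/k)} {p : ℕ} (E : IntermediateField k Ω)
    [FiniteDimensional k E] (h : ∀ x ∈ E, ∃ n : ℕ, (g ^ p ^ n) x = x) :
    ∃ n : ℕ, ∀ x ∈ E, (g ^ p ^ n) x = x := by
  choose n hn using fun i => h _ (Module.finBasis k E i).2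
  have hfix : ∀ {x : Ω} {a b : ℕ}, a ≤ b → (g ^ p ^ a) x = x → (g ^ p ^ b) x = x := by
    intro x a b hab hx
    obtain ⟨c, rfl⟩ := Nat.exists_eq_add_of_le hab
    rw [pow_add, pow_mul]
    have : g ^ p ^ a ∈ MulAction.stabilizer Gal(Ω/k) x := hx
    exact pow_mem this _
  refine ⟨Finset.univ.sup n, fun x hx => ?_⟩
  have hl : ((g ^ p ^ Finset.univ.sup n : Gal(Ω/k)).toLinearMap ∘ₗ E.val.toLinearMap)
      = E.val.toLinearMap :=
    (Module.finBasis k E).ext fun i => hfix (Finset.le_sup (Finset.mem_univ i)) (hn i)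
  exact LinearMap.congr_fun hl ⟨x, hx⟩

/-- The elements of `Ω` on which the subgroup `U` of `Gal(Ω/k)` acts as it has to act on the elements
of an admissible extension. All conditions refer to primes of `Ω` and to decomposition and inertia
groups in `Gal(Ω/k)`, so that different fields `F` (with `U = Gal(Ω/F)`) can be compared; see
`isAdmissible_iff`. -/
structure IsAdmissibleElt (p : ℕ) (e : ℕ∞) (S T : Set (Place k)) (U : Subgroup Gal(Ω/k))
    (x : Ω) : Prop where
  comm : ∀ g ∈ U, ∀ h ∈ U, g (h x) = h (g x)
  pro_p : ∀ g ∈ U, ∃ n : ℕ, (g ^ p ^ n) x = x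
  unramified : ∀ w : Place Ω, (∀ v ∈ S, ¬ w.LiesOver v) → ∀ g ∈ w.inertiaGroup k, g ∈ U → g x = x
  decomposed : ∀ w : Place Ω, ∀ v ∈ T, w.LiesOver v → ∀ g ∈ w.decompositionGroup k, g ∈ U → g x = x
  exponent : ∀ n : ℕ, e = n → ∀ g ∈ U, (g ^ p ^ n) x = x

variable {p : ℕ} {e : ℕ∞} {S T : Set (Place k)} {U : Subgroup Gal(Ω/k)}

theorem IsAdmissibleElt.mono {x : Ω} (h : IsAdmissibleElt p e S T U x) {T' : Set (Place k)}
    {U' : Subgroup Gal(Ω/k)} (hT : T' ⊆ T) (hU : U' ≤ U) : IsAdmissibleElt p e S T' U' x where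
  comm g hg g' hg' := h.comm g (hU hg) g' (hU hg')
  pro_p g hg := h.pro_p g (hU hg)
  unramified w hw g hg hgU := h.unramified w hw g hg (hU hgU)
  decomposed w v hv hw g hg hgU := h.decomposed w v (hT hv) hw g hg (hU hgU)
  exponent n hn g hg := h.exponent n hn g (hU hg)

theorem isAdmissibleElt_of_fixed {x : Ω} (h : ∀ g ∈ U, g x = x) :
    IsAdmissibleElt p e S T U x where
  comm g hg g' hg' := by rw [h g hg, h g' hg', h g hg]
  pro_p g hg := ⟨0, h _ (U.pow_mem hg _)⟩
  unramified _ _ g _ hgU := h g hgU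
  decomposed _ _ _ _ g _ hgU := h g hgU
  exponent n _ g hg := h _ (U.pow_mem hg _)

variable (p e S T U) in
/-- The field formed by the elements satisfying `IsAdmissibleElt`. When `U = Gal(Ω/F)`, it is
`L_{S,e}^T(F)`, regarded as an extension of `k`: see `mem_maxExt_iff`. -/
def admissibleField : IntermediateField k Ω where
  carrier := {x | IsAdmissibleElt p e S T U x}
  algebraMap_mem' a := isAdmissibleElt_of_fixed fun g _ => g.commutes a
  mul_mem' {x y} hx hy :=
    { comm g hg h hh := by simp only [map_mul, hx.comm g hg h hh, hy.comm g hg h hh]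
      pro_p g hg := by
        obtain ⟨a, ha⟩ := hx.pro_p g hg
        obtain ⟨b, hb⟩ := hy.pro_p g hg
        have ha' : g ^ p ^ a ∈ MulAction.stabilizer Gal(Ω/k) x := ha
        have hb' : g ^ p ^ b ∈ MulAction.stabilizer Gal(Ω/k) y := hb
        refine ⟨a + b, ?_⟩
        rw [map_mul]
        congr 1
        · rw [pow_add, pow_mul]; exact pow_mem ha' _
        · rw [add_comm, pow_add, pow_mul]; exact pow_mem hb' _
      unramified w hw g hg hgU := by
        rw [map_mul, hx.unramified w hw g hg hgU, hy.unramified w hw g hg hgU]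
      decomposed w v hv hw g hg hgU := by
        rw [map_mul, hx.decomposed w v hv hw g hg hgU, hy.decomposed w v hv hw g hg hgU]
      exponent n hn g hg := by rw [map_mul, hx.exponent n hn g hg, hy.exponent n hn g hg] }
  add_mem' {x y} hx hy :=
    { comm g hg h hh := by simp only [map_add, hx.comm g hg h hh, hy.comm g hg h hh]
      pro_p g hg := by
        obtain ⟨a, ha⟩ := hx.pro_p g hg
        obtain ⟨b, hb⟩ := hy.pro_p g hg
        have ha' : g ^ p ^ a ∈ MulAction.stabilizer Gal(Ω/k) x := ha
        have hb' : g ^ p ^ b ∈ MulAction.stabilizer Gal(Ω/k) y := hb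
        refine ⟨a + b, ?_⟩
        rw [map_add]
        congr 1
        · rw [pow_add, pow_mul]; exact pow_mem ha' _
        · rw [add_comm, pow_add, pow_mul]; exact pow_mem hb' _
      unramified w hw g hg hgU := by
        rw [map_add, hx.unramified w hw g hg hgU, hy.unramified w hw g hg hgU]
      decomposed w v hv hw g hg hgU := by
        rw [map_add, hx.decomposed w v hv hw g hg hgU, hy.decomposed w v hv hw g hg hgU]
      exponent n hn g hg := by rw [map_add, hx.exponent n hn g hg, hy.exponent n hn g hg] }
  inv_mem' x hx :=
    { comm g hg h hh := by simp only [map_inv₀, hx.comm g hg h hh]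
      pro_p g hg := by
        obtain ⟨a, ha⟩ := hx.pro_p g hg
        exact ⟨a, by rw [map_inv₀, ha]⟩
      unramified w hw g hg hgU := by rw [map_inv₀, hx.unramified w hw g hg hgU]
      decomposed w v hv hw g hg hgU := by rw [map_inv₀, hx.decomposed w v hv hw g hg hgU]
      exponent n hn g hg := by rw [map_inv₀, hx.exponent n hn g hg] }

theorem mem_admissibleField {x : Ω} :
    x ∈ admissibleField p e S T U ↔ IsAdmissibleElt p e S T U x := Iff.rfl

/-- If `U` is normal, the conditions are stable under `Gal(Ω/k)`, which permutes the primes of `Ω`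
over a given prime of `k`. -/
theorem IsAdmissibleElt.smul {x : Ω} (h : IsAdmissibleElt p e S T U x) [hU : U.Normal]
    (g : Gal(Ω/k)) : IsAdmissibleElt p e S T U (g x) := by
  have hconj : ∀ a ∈ U, g⁻¹ * a * g ∈ U := fun a ha => by
    simpa only [inv_inv] using hU.conj_mem a ha g⁻¹
  have hpow : ∀ (a : Gal(Ω/k)) (m : ℕ), (a ^ m) (g x) = g (((g⁻¹ * a * g) ^ m) x) := fun a m => by
    have : (g⁻¹ * a * g) ^ m = g⁻¹ * a ^ m * g := by
      simpa only [inv_inv] using (conj_pow (a := g⁻¹) (b := a) (i := m))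
    rw [this, ← AlgEquiv.mul_apply, ← AlgEquiv.mul_apply]
    congr 1
    group
  have h1 : ∀ a : Gal(Ω/k), a (g x) = g ((g⁻¹ * a * g) x) := fun a => by
    simpa only [pow_one] using hpow a 1
  have hw : ∀ w : Place Ω, ∃ w', Place.IsComap (g : Ω →+* Ω) w w' ∧
      ∀ v : Place k, w'.LiesOver v → w.LiesOver v := by
    intro w
    obtain ⟨w', hw'⟩ := Place.exists_isComap (g : Ω →+* Ω) w
    refine ⟨w', hw', fun v hv => ?_⟩
    rw [Place.liesOver_iff] at hv ⊢
    have : (g : Ω →+* Ω).comp (algebraMap k Ω) = algebraMap k Ω := RingHom.ext g.commutes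
    exact this ▸ hw'.comp hv
  have hcomp : ∀ a : Gal(Ω/k), (a : Ω →+* Ω).comp (g : Ω →+* Ω)
      = (g : Ω →+* Ω).comp ((g⁻¹ * a * g : Gal(Ω/k)) : Ω →+* Ω) := fun a =>
    RingHom.ext fun y => by
      change a (g y) = g (g⁻¹ (a (g y)))
      exact (AlgEquiv.apply_symm_apply g _).symm
  refine ⟨fun a ha b hb => ?_, fun a ha => ?_, fun w hwS a ha haU => ?_,
    fun w v hv hwv a ha haU => ?_, fun n hn a ha => ?_⟩
  · have e1 : ∀ a b : Gal(Ω/k), a (b (g x)) = g ((g⁻¹ * a * g) ((g⁻¹ * b * g) x)) := by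
      intro a b
      rw [← AlgEquiv.mul_apply a b, h1,
        ← AlgEquiv.mul_apply (g⁻¹ * a * g) (g⁻¹ * b * g)]
      congr 2
      group
    rw [e1, e1, h.comm _ (hconj a ha) _ (hconj b hb)]
  · obtain ⟨n, hn⟩ := h.pro_p _ (hconj a ha)
    exact ⟨n, by rw [hpow, hn]⟩
  · obtain ⟨w', hw', hover⟩ := hw w
    rw [h1, h.unramified w' (fun v hv hl => hwS v hv (hover v hl)) _ ?_ (hconj a haU)]
    exact Place.mem_inertiaGroup_iff.2
      ((Place.mem_inertiaGroup_iff.1 ha).of_comp hw' (hcomp a))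
  · obtain ⟨w', hw', hover⟩ := hw w
    have hw'v : w'.LiesOver v := by
      obtain ⟨v', hv'⟩ := Place.exists_liesOver k w'
      rwa [hwv.unique (hover v' hv')]
    rw [h1, h.decomposed w' v hv hw'v _ ?_ (hconj a haU)]
    exact Place.mem_decompositionGroup_iff.2
      (hw'.of_comp_eq (hcomp a) (Place.mem_decompositionGroup_iff.1 ha))
  · rw [hpow, h.exponent n hn _ (hconj a ha)]

theorem mem_fixingSubgroup_admissibleField {g : Gal(Ω/k)} :
    g ∈ (admissibleField p e S T U).fixingSubgroup ↔
      ∀ x, IsAdmissibleElt p e S T U x → g x = x :=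
  mem_fixingSubgroup_iff _

instance normal_fixingSubgroup_admissibleField [U.Normal] :
    (admissibleField p e S T U).fixingSubgroup.Normal := by
  refine ⟨fun h hh g => mem_fixingSubgroup_admissibleField.2 fun x hx => ?_⟩
  rw [AlgEquiv.mul_apply, AlgEquiv.mul_apply,
    mem_fixingSubgroup_admissibleField.1 hh _ (hx.smul g⁻¹)]
  exact AlgEquiv.apply_symm_apply g x

theorem commutatorElement_mem_fixingSubgroup {g h : Gal(Ω/k)} (hg : g ∈ U) (hh : h ∈ U) :
    ⁅g, h⁆ ∈ (admissibleField p e S T U).fixingSubgroup := by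
  refine mem_fixingSubgroup_admissibleField.2 fun x hx => ?_
  rw [commutatorElement_def, AlgEquiv.mul_apply, AlgEquiv.mul_apply, AlgEquiv.mul_apply,
    hx.comm _ (U.inv_mem hg) _ (U.inv_mem hh)]
  change g (h (h.symm (g.symm x))) = x
  rw [AlgEquiv.apply_symm_apply, AlgEquiv.apply_symm_apply]

end

section

variable {k F Ω : Type*} [Field k] [Field F] [Field Ω] [Algebra k F] [Algebra F Ω]
  [Algebra k Ω] [IsScalarTower k F Ω] [IsGalois F Ω]
  {p : ℕ} {e : ℕ∞} {S T : Set (Place k)}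

omit [IsGalois F Ω] in
theorem isScalarTower_intermediateField (M : IntermediateField F Ω) : IsScalarTower k M Ω :=
  .of_algebraMap_eq fun _ => rfl

theorem IsAdmissible.isAdmissibleElt {M : IntermediateField F Ω} (hM : IsAdmissible p e S T F M)
    {x : Ω} (hx : x ∈ M) : IsAdmissibleElt p e S T (fieldStabilizer k Ω F) x := by
  have hab := hM.abelian
  have htower := isScalarTower_intermediateField (k := k) M
  let x' : M := ⟨x, hx⟩
  -- restriction to `M` of an element of `Gal(Ω/k)` fixing `F`
  have hr : ∀ g ∈ fieldStabilizer k Ω F, ∃ r : Gal(M/F),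
      ∀ (m : ℕ) (y : M), ((r ^ m) y : Ω) = (g ^ m) y := by
    intro g hg
    obtain ⟨g', hg'⟩ := exists_gal_of_mem_fieldStabilizer hg
    refine ⟨g'.restrictNormal M, fun m => ?_⟩
    induction m with
    | zero => exact fun y => rfl
    | succ m ih =>
      intro y
      rw [pow_succ, pow_succ, AlgEquiv.mul_apply, AlgEquiv.mul_apply, ih]
      congr 1
      exact (AlgEquiv.restrictNormal_commutes g' M y).trans (RingHom.congr_fun hg' _)
  have hr' : ∀ g ∈ fieldStabilizer k Ω F, ∃ r : Gal(M/F), ∀ y : M, (r y : Ω) = g y ∧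
      (g : Ω →+* Ω).comp (algebraMap M Ω) = (algebraMap M Ω).comp (r : M →+* M) := by
    intro g hg
    obtain ⟨r, hr⟩ := hr g hg
    have : ∀ y : M, (r y : Ω) = g y := fun y => by simpa using hr 1 y
    exact ⟨r, fun y => ⟨this y, RingHom.ext fun z => (this z).symm⟩⟩
  refine ⟨fun g hg h hh => ?_, fun g hg => ?_, fun w hw g hg hgU => ?_,
    fun w v hv hwv g hg hgU => ?_, fun n hn g hg => ?_⟩
  · obtain ⟨r, hr⟩ := hr' g hg
    obtain ⟨s, hs⟩ := hr' h hh
    have e1 : (r * s) x' = (s * r) x' := by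
      rw [(inferInstance : IsMulCommutative Gal(M/F)).is_comm.comm r s]
    have e2 := congrArg Subtype.val e1
    rw [AlgEquiv.mul_apply, AlgEquiv.mul_apply, (hr _).1, (hs _).1, (hs _).1, (hr _).1] at e2
    exact e2
  · obtain ⟨r, hr⟩ := hr g hg
    have ho : IsOpen (MulAction.stabilizer Gal(M/F) x' : Set Gal(M/F)) :=
      stabilizer_isOpen_of_isIntegral x'
    obtain ⟨V, hV⟩ := ProfiniteGrp.exist_openNormalSubgroup_sub_open_nhds_of_one ho
      (one_mem _)
    obtain ⟨n, hn⟩ := hM.pro_p V (QuotientGroup.mk r)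
    have h1 : r ^ p ^ n ∈ V.toSubgroup := (QuotientGroup.eq_one_iff _).1 hn
    have h2 : (r ^ p ^ n) x' = x' := hV h1
    exact ⟨n, by rw [← hr _ x', h2]⟩
  · obtain ⟨r, hr⟩ := hr' g hgU
    obtain ⟨u, hu⟩ := Place.exists_liesOver M w
    have h1 : r ∈ u.inertiaGroup F := Place.mem_inertiaGroup_iff.2
      ((Place.mem_inertiaGroup_iff.1 hg).of_comp (Place.liesOver_iff.1 hu) (hr x').2)
    rw [hM.unramified u fun v hv h => hw v hv (hu.trans h)] at h1
    rw [← (hr x').1, Subgroup.mem_bot.1 h1]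
    rfl
  · obtain ⟨r, hr⟩ := hr' g hgU
    obtain ⟨u, hu⟩ := Place.exists_liesOver M w
    have h1 : r ∈ u.decompositionGroup F := Place.mem_decompositionGroup_iff.2
      ((Place.liesOver_iff.1 hu).of_comp_eq (hr x').2 (Place.mem_decompositionGroup_iff.1 hg))
    rw [hM.decomposed u v hv (hu.of_tower hwv)] at h1
    rw [← (hr x').1, Subgroup.mem_bot.1 h1]
    rfl
  · obtain ⟨r, hr⟩ := hr g hg
    rw [← hr _ x', hM.exponent n hn r]
    rfl

/-- Normality of `M/F` is not assumed: it follows from the commutativity condition. -/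
theorem isAdmissible_of_forall_mem {M : IntermediateField F Ω}
    (hM : ∀ x ∈ M, IsAdmissibleElt p e S T (fieldStabilizer k Ω F) x) :
    IsAdmissible p e S T F M := by
  have hN : Normal F M := by
    refine IntermediateField.normal_iff_forall_map_le'.2 fun σ => ?_
    rintro _ ⟨x, hx, rfl⟩
    change σ x ∈ M
    rw [← InfiniteGalois.fixedField_fixingSubgroup M, IntermediateField.mem_fixedField_iff]
    intro τ hτ
    have h1 : τ (σ x) = σ (τ x) := (hM x hx).comm
      _ (restrictScalars_mem_fieldStabilizer τ) _ (restrictScalars_mem_fieldStabilizer σ)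
    change τ (σ x) = σ x
    rw [h1]
    exact congrArg σ ((mem_fixingSubgroup_iff Gal(Ω/F)).1 hτ x hx)
  have hG : IsGalois F M :=
    { to_isSeparable := Algebra.isSeparable_tower_bot_of_isSeparable F M Ω }
  have htower := isScalarTower_intermediateField (k := k) M
  have hlift : ∀ σ : Gal(M/F), ∃ g : Gal(Ω/F), ∀ x : M, (σ x : Ω) = g x := fun σ => by
    obtain ⟨g, rfl⟩ := AlgEquiv.restrictNormalHom_surjective (F := F) (K₁ := M) Ω σ
    exact ⟨g, fun x => AlgEquiv.restrictNormal_commutes g M x⟩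
  have hpow : ∀ (σ : Gal(M/F)) (g : Gal(Ω/F)), (∀ x : M, (σ x : Ω) = g x) →
      ∀ (m : ℕ) (x : M), ((σ ^ m) x : Ω) = (AlgEquiv.restrictScalarsHom k g ^ m) x := by
    intro σ g h m
    induction m with
    | zero => exact fun _ => rfl
    | succ m ih =>
      intro x
      rw [pow_succ, pow_succ, AlgEquiv.mul_apply, AlgEquiv.mul_apply, ih, h]
      rfl
  refine ⟨{ is_comm := ⟨fun σ τ => AlgEquiv.ext fun x => Subtype.ext ?_⟩ }, ?_, ?_, ?_, ?_⟩
  · obtain ⟨g, hg⟩ := hlift σ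
    obtain ⟨h, hh⟩ := hlift τ
    rw [AlgEquiv.mul_apply, AlgEquiv.mul_apply, hg, hh, hh, hg]
    exact (hM x x.2).comm _ (restrictScalars_mem_fieldStabilizer g) _
      (restrictScalars_mem_fieldStabilizer h)
  · intro V σ
    obtain ⟨σ, rfl⟩ := QuotientGroup.mk_surjective σ
    obtain ⟨g, hg⟩ := hlift σ
    obtain ⟨E, hE, hEV⟩ := (krullTopology_mem_nhds_one_iff F M _).1
      (V.isOpen'.mem_nhds V.toSubgroup.one_mem)
    obtain ⟨n, hn⟩ := exists_pow_forall_mem (g := σ) (p := p) E fun x _ => by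
      obtain ⟨n, hn⟩ := (hM x x.2).pro_p _ (restrictScalars_mem_fieldStabilizer g)
      exact ⟨n, Subtype.ext (by rw [hpow σ g hg, hn])⟩
    exact ⟨n, (QuotientGroup.eq_one_iff _).2 (hEV ((mem_fixingSubgroup_iff _).2 hn))⟩
  · intro u hu
    rw [eq_bot_iff]
    intro σ hσ
    obtain ⟨w, hw⟩ := Place.exists_liesOver_of_isAlgebraic Ω u
    obtain ⟨τ, hτ, hτσ⟩ := Place.exists_mem_inertiaGroup hw hσ
    refine Subgroup.mem_bot.2 (AlgEquiv.ext fun x => Subtype.ext ?_)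
    refine (hτσ x).symm.trans ((hM x x.2).unramified w (fun v hv h => hu v hv (hw.of_tower h))
      (AlgEquiv.restrictScalarsHom k τ) ?_ (restrictScalars_mem_fieldStabilizer τ))
    exact Place.mem_inertiaGroup_iff.2
      (show Place.IsInertial (τ : Ω →+* Ω) w from Place.mem_inertiaGroup_iff.1 hτ)
  · intro u v hv huv
    rw [eq_bot_iff]
    intro σ hσ
    obtain ⟨w, hw⟩ := Place.exists_liesOver_of_isAlgebraic Ω u
    obtain ⟨τ, hτ, hτσ⟩ := Place.exists_mem_decompositionGroup hw hσ
    refine Subgroup.mem_bot.2 (AlgEquiv.ext fun x => Subtype.ext ?_)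
    refine (hτσ x).symm.trans ((hM x x.2).decomposed w v hv (hw.trans huv)
      (AlgEquiv.restrictScalarsHom k τ) ?_ (restrictScalars_mem_fieldStabilizer τ))
    exact Place.mem_decompositionGroup_iff.2
      (show Place.IsComap (τ : Ω →+* Ω) w w from Place.mem_decompositionGroup_iff.1 hτ)
  · intro n hn σ
    obtain ⟨g, hg⟩ := hlift σ
    refine AlgEquiv.ext fun x => Subtype.ext ?_
    rw [hpow σ g hg]
    exact (hM x x.2).exponent n hn _ (restrictScalars_mem_fieldStabilizer g)

/-- Admissibility of `M/F` can be tested element by element in `Gal(Ω/k)`. -/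
theorem isAdmissible_iff {M : IntermediateField F Ω} :
    IsAdmissible p e S T F M ↔
      ∀ x ∈ M, IsAdmissibleElt p e S T (fieldStabilizer k Ω F) x :=
  ⟨fun h _ hx => h.isAdmissibleElt hx, isAdmissible_of_forall_mem⟩

variable (F) in
/-- The admissible elements form the largest admissible extension. -/
theorem mem_maxExt_iff {x : Ω} :
    x ∈ maxExt p e S T F Ω ↔ IsAdmissibleElt p e S T (fieldStabilizer k Ω F) x := by
  let B : IntermediateField F Ω :=
    { (admissibleField p e S T (fieldStabilizer k Ω F)).toSubfield with
      algebraMap_mem' := fun a => isAdmissibleElt_of_fixed fun g hg =>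
        mem_fieldStabilizer.1 hg a }
  have hB : ∀ {x}, x ∈ B ↔ IsAdmissibleElt p e S T (fieldStabilizer k Ω F) x := Iff.rfl
  have : maxExt p e S T F Ω = B := by
    refine le_antisymm (sSup_le fun M hM x hx => ?_) (le_sSup ?_)
    · exact hB.2 (isAdmissible_iff.1 hM x hx)
    · exact isAdmissible_iff.2 fun x hx => hB.1 hx
  rw [this, hB]

end

/-! ### The tower `K ⊆ K' ⊆ K''` -/

section

variable {K K' K'' Ω : Type*} [Field K] [Field K'] [Field K''] [Field Ω]
  [Algebra K K'] [Algebra K K''] [Algebra K' K''] [IsScalarTower K K' K'']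
  [Algebra K Ω] [Algebra K' Ω] [Algebra K'' Ω]
  [IsScalarTower K K' Ω] [IsScalarTower K K'' Ω] [IsScalarTower K' K'' Ω] [IsGalois K Ω]

variable (K K' K'' Ω) in
omit [Algebra K K'] [Algebra K K''] [IsScalarTower K K' K'']
  [IsScalarTower K K' Ω] [IsScalarTower K K'' Ω] [IsGalois K Ω] in
theorem fieldStabilizer_le : fieldStabilizer K Ω K'' ≤ fieldStabilizer K Ω K' := fun g hg =>
  mem_fieldStabilizer.2 fun x => by
    rw [IsScalarTower.algebraMap_apply K' K'' Ω]
    exact mem_fieldStabilizer.1 hg _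

variable (K K'' Ω) in
omit [IsGalois K Ω] in
theorem ker_restrictNormalHom [Normal K K''] :
    (AlgEquiv.restrictNormalHom (F := K) (K₁ := Ω) K'').ker = fieldStabilizer K Ω K'' := by
  ext g
  rw [MonoidHom.mem_ker, mem_fieldStabilizer]
  constructor
  · intro h x
    have := AlgEquiv.restrictNormal_commutes g K'' x
    rw [show g.restrictNormal K'' = 1 from h] at this
    exact this.symm
  · intro h
    refine AlgEquiv.ext fun x => (algebraMap K'' Ω).injective ?_
    exact (AlgEquiv.restrictNormal_commutes g K'' x).trans (h x)

variable (K K'' Ω) in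
omit [IsGalois K Ω] in
theorem isOpen_fieldStabilizer [FiniteDimensional K K''] :
    IsOpen (fieldStabilizer K Ω K'' : Set Gal(Ω/K)) := by
  have : FiniteDimensional K (IsScalarTower.toAlgHom K K'' Ω).fieldRange :=
    LinearMap.finiteDimensional_range (IsScalarTower.toAlgHom K K'' Ω).toLinearMap
  have h := IntermediateField.fixingSubgroup_isOpen (IsScalarTower.toAlgHom K K'' Ω).fieldRange
  exact h

omit [IsScalarTower K K' Ω] [IsGalois K Ω] in
/-- In a cyclic extension `K''/K` of degree `p ^ 2` with intermediate field `K'` of degree `p`,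
the elements of the Galois group of order dividing `p` are those fixing `K'`. -/
theorem restrictNormalHom_pow_eq_one_iff {p : ℕ} (hp : p.Prime) [IsGalois K K'']
    [IsCyclic Gal(K''/K)] (hK' : Module.finrank K K' = p) (hK'' : Module.finrank K K'' = p ^ 2)
    {g : Gal(Ω/K)} :
    AlgEquiv.restrictNormalHom K'' g ^ p = 1 ↔ g ∈ fieldStabilizer K Ω K' := by
  have hfin : FiniteDimensional K K'' :=
    Module.finite_of_finrank_pos (by rw [hK'']; exact pow_pos hp.pos 2)
  have hfin' : FiniteDimensional K' K'' := Module.Finite.of_restrictScalars_finite K K' K''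
  have hgal : IsGalois K' K'' := IsGalois.tower_top_of_isGalois K K' K''
  have hcard : Nat.card Gal(K''/K') = p := by
    rw [IsGalois.card_aut_eq_finrank]
    have := Module.finrank_mul_finrank K K' K''
    rw [hK', hK'', pow_two] at this
    exact Nat.eq_of_mul_eq_mul_left hp.pos this
  have key : ∀ c : Gal(K''/K), c ^ p = 1 ↔ c ∈ fieldStabilizer K K'' K' := by
    have hle : ∀ c ∈ fieldStabilizer K K'' K', c ^ p = 1 := by
      intro c hc
      obtain ⟨c', hc'⟩ := exists_gal_of_mem_fieldStabilizer hc
      have e : c = AlgEquiv.restrictScalarsHom K c' :=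
        AlgEquiv.ext fun x => (RingHom.congr_fun hc' x).symm
      rw [e, ← map_pow, ← hcard, pow_card_eq_one', map_one]
    classical
    have hcardH : p ≤ Nat.card (fieldStabilizer K K'' K') := by
      rw [← hcard]
      exact Nat.card_le_card_of_injective
        (fun c => (⟨_, restrictScalars_mem_fieldStabilizer c⟩ : fieldStabilizer K K'' K'))
        fun a b h => AlgEquiv.restrictScalarsHom_injective K (congrArg Subtype.val h)
    have : Fintype Gal(K''/K) := Fintype.ofFinite _
    have hsub : (fieldStabilizer K K'' K' : Set Gal(K''/K)).toFinset ⊆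
        Finset.univ.filter fun c : Gal(K''/K) => c ^ p = 1 := fun c hc => by
      simpa using hle c (by simpa using hc)
    have heq := Finset.eq_of_subset_of_card_le hsub <|
      (IsCyclic.card_pow_eq_one_le hp.pos).trans <| by
        rw [Set.toFinset_card, ← Nat.card_eq_fintype_card]
        exact hcardH
    intro c
    have := Finset.ext_iff.1 heq c
    simpa using this.symm
  rw [key, mem_fieldStabilizer, mem_fieldStabilizer]
  refine forall_congr' fun x => ?_
  rw [← (algebraMap K'' Ω).injective.eq_iff, IsScalarTower.algebraMap_apply K' K'' Ω,
    ← AlgEquiv.restrictNormal_commutes g K'']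
  rfl

variable {p : ℕ} {e : ℕ∞} {S T Sigma : Set (Place K)}

/-- The decomposition group of a prime which does not split in `K'` surjects onto the cyclic
group `Gal(K''/K)`. -/
theorem map_decompositionGroup_eq_top (hp : p.Prime) [IsGalois K K'']
    [IsCyclic Gal(K''/K)] (hK' : Module.finrank K K' = p) (hK'' : Module.finrank K K'' = p ^ 2)
    (hT : NonSplit K K' T) {w : Place Ω} {v : Place K} (hv : v ∈ T) (hw : w.LiesOver v) :
    (w.decompositionGroup K).map (AlgEquiv.restrictNormalHom K'') = ⊤ := by
  have hfin : FiniteDimensional K K'' :=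
    Module.finite_of_finrank_pos (by rw [hK'']; exact pow_pos hp.pos 2)
  have hcard : Nat.card Gal(K''/K) = p ^ 2 := by rw [IsGalois.card_aut_eq_finrank, hK'']
  obtain ⟨c, hc⟩ := IsCyclic.exists_generator (α := Gal(K''/K))
  obtain ⟨σ, rfl⟩ := AlgEquiv.restrictNormalHom_surjective (F := K) (K₁ := K'') Ω c
  have hgal : IsGalois K' Ω := IsGalois.tower_top_of_isGalois K K' Ω
  obtain ⟨w₁, hw₁⟩ := Place.exists_isComap (σ : Ω →+* Ω) w
  have hw₁v : w₁.LiesOver v := by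
    rw [Place.liesOver_iff] at hw ⊢
    refine hw₁.of_comp ?_
    have : (σ : Ω →+* Ω).comp (algebraMap K Ω) = algebraMap K Ω := RingHom.ext σ.commutes
    rwa [this]
  obtain ⟨u, hu⟩ := Place.exists_liesOver K' w
  obtain ⟨u₁, hu₁⟩ := Place.exists_liesOver K' w₁
  have huu : u₁ = u := (hT v hv).unique (hu₁.of_tower hw₁v) (hu.of_tower hw)
  obtain ⟨τ, hτ⟩ := Place.exists_isComap_of_liesOver (F := K') hu₁ (huu ▸ hu)
  set d := σ * AlgEquiv.restrictScalarsHom K τ with hd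
  have hdw : d ∈ w.decompositionGroup K := Place.mem_decompositionGroup_iff.2 (hw₁.comp hτ)
  have hτ1 : AlgEquiv.restrictNormalHom K'' (AlgEquiv.restrictScalarsHom K τ) ^ p = 1 :=
    (restrictNormalHom_pow_eq_one_iff hp hK' hK'').2 (restrictScalars_mem_fieldStabilizer τ)
  have hσ2 : orderOf (AlgEquiv.restrictNormalHom K'' σ) = p ^ 2 := by
    rw [orderOf_eq_card_of_forall_mem_zpowers hc, hcard]
  have hcomm : Commute (AlgEquiv.restrictNormalHom K'' σ)
      (AlgEquiv.restrictNormalHom K'' (AlgEquiv.restrictScalarsHom K τ)) := by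
    obtain ⟨i, hi⟩ := hc (AlgEquiv.restrictNormalHom K'' (AlgEquiv.restrictScalarsHom K τ))
    rw [← hi]
    exact (Commute.refl _).zpow_right i
  have := Fact.mk hp
  have hd2 : orderOf (AlgEquiv.restrictNormalHom K'' d) = p ^ 2 := by
    refine orderOf_eq_prime_pow (n := 1) ?_ (hcard ▸ pow_card_eq_one')
    rw [hd, map_mul, pow_one, hcomm.mul_pow, hτ1, mul_one]
    intro h
    have h1 := Nat.le_of_dvd hp.pos (hσ2 ▸ orderOf_dvd_of_pow_eq_one h)
    nlinarith [hp.two_le]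
  have hz : Subgroup.zpowers (AlgEquiv.restrictNormalHom K'' d) = ⊤ :=
    Subgroup.eq_top_of_card_eq _ (by rw [Nat.card_zpowers, hd2, hcard])
  rw [eq_top_iff, ← hz, Subgroup.zpowers_le]
  exact ⟨d, hdw, rfl⟩

/-- The inertia group of a prime over a totally ramified prime surjects onto `Gal(K''/K)`. -/
theorem map_inertiaGroup_eq_top [IsGalois K K''] {R : Set (Place K)}
    (hR : TotallyRamifiedOver K K K'' R) {w : Place Ω} {v : Place K} (hv : v ∈ R)
    (hw : w.LiesOver v) :
    (w.inertiaGroup K).map (AlgEquiv.restrictNormalHom K'') = ⊤ := by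
  rw [eq_top_iff]
  intro c _
  obtain ⟨u, hu⟩ := Place.exists_liesOver K'' w
  have hc : c ∈ u.inertiaGroup K := hR u v hv (hu.of_tower hw) ▸ Subgroup.mem_top c
  obtain ⟨τ, hτ, hτc⟩ := Place.exists_mem_inertiaGroup hu hc
  exact ⟨τ, hτ, AlgEquiv.ext fun x => (algebraMap K'' Ω).injective
    ((AlgEquiv.restrictNormal_commutes τ K'' x).trans (hτc x))⟩

/-- At a nonarchimedean prime, decomposition groups are procyclic modulo inertia. -/
theorem exists_decompositionGroup_le_zpowers_sup {w : Place Ω} (V : Subgroup Gal(Ω/K)) [V.Normal]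
    (hVo : IsOpen (V : Set Gal(Ω/K))) (hV : w.inertiaGroup K ≤ V) :
    ∃ δ ∈ w.decompositionGroup K, w.decompositionGroup K ≤ Subgroup.zpowers δ ⊔ V := by
  cases w with
  | infinite w => exact ⟨1, Subgroup.one_mem _, hV.trans le_sup_right⟩
  | finite Q =>
    let E := IntermediateField.fixedField V
    have hEV : E.fixingSubgroup = V := InfiniteGalois.fixingSubgroup_fixedField
      ⟨V, Subgroup.isClosed_of_isOpen V hVo⟩
    have hfin : FiniteDimensional K E := by
      refine (InfiniteGalois.isOpen_iff_finite E).1 ?_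
      change IsOpen (E.fixingSubgroup : Set Gal(Ω/K))
      rwa [hEV]
    have hgal : IsGalois K E := by
      refine (InfiniteGalois.normal_iff_isGalois E).1 ?_
      rwa [hEV]
    obtain ⟨u, hu⟩ := Place.exists_liesOver E (Place.finite Q)
    cases u with
    | infinite u => exact hu.elim
    | finite P =>
    have hI : (Place.finite P).inertiaGroup K = ⊥ := by
      rw [eq_bot_iff]
      intro σ hσ
      obtain ⟨τ, hτ, hτσ⟩ := Place.exists_mem_inertiaGroup hu hσ
      have h1 : τ ∈ E.fixingSubgroup := hEV ▸ hV hτ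
      refine Subgroup.mem_bot.2 (AlgEquiv.ext fun x => Subtype.ext ?_)
      exact (hτσ x).symm.trans ((mem_fixingSubgroup_iff Gal(Ω/K)).1 h1 x x.2)
    have hcyc : IsCyclic ((Place.finite P).decompositionGroup K) :=
      Place.isCyclic_of_inf_inertia_eq_bot P _ le_rfl (by rw [hI, inf_bot_eq])
    obtain ⟨⟨c, hcP⟩, hc⟩ := hcyc.exists_generator
    obtain ⟨δ, hδ, hδc⟩ := Place.exists_mem_decompositionGroup hu hcP
    have hres : ∀ g : Gal(Ω/K), ∀ x : E, g x = (AlgEquiv.restrictNormalHom E g x : E) :=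
      fun g x => (AlgEquiv.restrictNormal_commutes g E x).symm
    have hδ' : AlgEquiv.restrictNormalHom E δ = c :=
      AlgEquiv.ext fun x => Subtype.ext ((hres δ x).symm.trans (hδc x))
    refine ⟨δ, hδ, fun d hd => ?_⟩
    have hdP : AlgEquiv.restrictNormalHom E d ∈ (Place.finite P).decompositionGroup K :=
      Place.mem_decompositionGroup_iff.2 ((Place.liesOver_iff.1 hu).of_comp_eq
        (RingHom.ext fun x => hres d x) (Place.mem_decompositionGroup_iff.1 hd))
    obtain ⟨j, hj⟩ := hc ⟨_, hdP⟩
    have hj' : c ^ j = AlgEquiv.restrictNormalHom E d := congrArg Subtype.val hj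
    have hmem : δ ^ (-j) * d ∈ V := by
      rw [← hEV]
      refine (mem_fixingSubgroup_iff Gal(Ω/K)).2 fun x hx => ?_
      have h1 : AlgEquiv.restrictNormalHom E (δ ^ (-j) * d) = 1 := by
        rw [map_mul, map_zpow, hδ', ← hj', ← zpow_add, neg_add_cancel, zpow_zero]
      exact (hres _ ⟨x, hx⟩).trans (by rw [h1]; rfl)
    have := Subgroup.mul_mem_sup (Subgroup.zpow_mem _ (Subgroup.mem_zpowers δ) j) hmem
    rwa [← mul_assoc, ← zpow_add, add_neg_cancel, zpow_zero, one_mul] at this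

end

section

variable {K K' K'' Ω : Type*} [Field K] [Field K'] [Field K''] [Field Ω]
  [Algebra K K'] [Algebra K K''] [Algebra K' K''] [IsScalarTower K K' K'']
  [Algebra K Ω] [Algebra K' Ω] [Algebra K'' Ω]
  [IsScalarTower K K' Ω] [IsScalarTower K K'' Ω] [IsScalarTower K' K'' Ω] [IsGalois K Ω]
  {p : ℕ} {S T T₀ Sigma : Set (Place K)}

/-- The inertia groups in `Gal(Ω/K)` of the primes over `Sigma \ (S ∪ T)` and the decomposition
groups of the primes over `T`. They act trivially on `L_{S,e}^T(K)`, but surject onto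
`Gal(K''/K)`. -/
def localGroups (Ω : Type*) [Field Ω] [Algebra K Ω] (Sigma S T : Set (Place K)) :
    Set (Subgroup Gal(Ω/K)) :=
  {J | ∃ w : Place Ω, (∃ v ∈ Sigma \ (S ∪ T), w.LiesOver v ∧ J = w.inertiaGroup K) ∨
    ∃ v ∈ T, w.LiesOver v ∧ J = w.decompositionGroup K}

theorem map_eq_top_of_mem_localGroups (hp : p.Prime) [IsGalois K K''] [IsCyclic Gal(K''/K)]
    (hK' : Module.finrank K K' = p) (hK'' : Module.finrank K K'' = p ^ 2)
    (h2 : TotallyRamifiedOver K K K'' (Sigma \ (S ∪ T))) (h3 : NonSplit K K' T)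
    {J : Subgroup Gal(Ω/K)} (hJ : J ∈ localGroups Ω Sigma S T) :
    J.map (AlgEquiv.restrictNormalHom K'') = ⊤ := by
  obtain ⟨w, ⟨v, hv, hw, rfl⟩ | ⟨v, hv, hw, rfl⟩⟩ := hJ
  · exact map_inertiaGroup_eq_top h2 hv hw
  · exact map_decompositionGroup_eq_top hp hK' hK'' h3 hv hw

omit [IsGalois K Ω] in
theorem not_liesOver_of_notMem {w : Place Ω} {v : Place K} (hw : w.LiesOver v) (hv : v ∉ S) :
    ∀ v' ∈ S, ¬ w.LiesOver v' := fun _ hv' h => hv (hw.unique h ▸ hv')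

omit [IsGalois K Ω] in
theorem le_fixingSubgroup_of_mem_localGroups {e : ℕ∞}
    {J : Subgroup Gal(Ω/K)} (hJ : J ∈ localGroups Ω Sigma S T) :
    J ≤ (admissibleField p e S T (⊤ : Subgroup Gal(Ω/K))).fixingSubgroup := by
  intro g hg
  refine mem_fixingSubgroup_admissibleField.2 fun x hx => ?_
  obtain ⟨w, ⟨v, hv, hw, rfl⟩ | ⟨v, hv, hw, rfl⟩⟩ := hJ
  · exact hx.unramified w (not_liesOver_of_notMem hw fun h => hv.2 (Or.inl h)) g hg trivial
  · exact hx.decomposed w v hv hw g hg trivial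

/-- If the restriction map `A(K') → A(K)` is injective, then an automorphism trivial on `K''` and
on `L_{S,e}^T(K)` is trivial on `L_{S,e}^{T₀}(K'')`. -/
theorem fixingSubgroup_inf_le (hp : p.Prime) [IsGalois K K''] [IsCyclic Gal(K''/K)]
    (hST : S ∩ T = ∅) (hK' : Module.finrank K K' = p) (hK'' : Module.finrank K K'' = p ^ 2)
    (hunr : UnramifiedOutside K K K'' Sigma)
    (h2 : TotallyRamifiedOver K K K'' (Sigma \ (S ∪ T))) (h3 : NonSplit K K' T) (e : ℕ∞)
    (hT₀ : T₀ ⊆ T) (hST₀ : Sigma ∩ T ⊆ T₀) (hne : (Sigma \ (S ∪ T) ∪ T₀).Nonempty)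
    (hinj : (admissibleField p e S T (⊤ : Subgroup Gal(Ω/K))).fixingSubgroup ⊓
      fieldStabilizer K Ω K'' ≤ (admissibleField p e S T (fieldStabilizer K Ω K')).fixingSubgroup) :
    (admissibleField p e S T (⊤ : Subgroup Gal(Ω/K))).fixingSubgroup ⊓ fieldStabilizer K Ω K'' ≤
      (admissibleField p e S T₀ (fieldStabilizer K Ω K'')).fixingSubgroup := by
  have := Fact.mk hp
  have hfin : FiniteDimensional K K'' :=
    Module.finite_of_finrank_pos (by rw [hK'']; exact pow_pos hp.pos 2)
  have hcard : Nat.card Gal(K''/K) = p ^ 2 := by rw [IsGalois.card_aut_eq_finrank, hK'']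
  have hker := ker_restrictNormalHom K K'' Ω
  have hnorm : (fieldStabilizer K Ω K'').Normal := hker ▸ inferInstance
  have hmap : ∀ J ∈ localGroups Ω Sigma S T, J.map (AlgEquiv.restrictNormalHom K'') = ⊤ :=
    fun J hJ => map_eq_top_of_mem_localGroups hp hK' hK'' h2 h3 hJ
  set R := (admissibleField p e S T₀ (fieldStabilizer K Ω K'')).fixingSubgroup with hR
  -- inertia outside `S` and decomposition over `T₀` meet `Gal(Ω/K'')` inside `R`
  have hIR : ∀ {w : Place Ω} {v : Place K}, w.LiesOver v → v ∉ S →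
      w.inertiaGroup K ⊓ fieldStabilizer K Ω K'' ≤ R := fun hw hv g hg =>
    mem_fixingSubgroup_admissibleField.2 fun x hx =>
      hx.unramified _ (not_liesOver_of_notMem hw hv) g hg.1 hg.2
  have hDR : ∀ {w : Place Ω} {v : Place K}, w.LiesOver v → v ∈ T₀ →
      w.decompositionGroup K ⊓ fieldStabilizer K Ω K'' ≤ R := fun hw hv g hg =>
    mem_fixingSubgroup_admissibleField.2 fun x hx => hx.decomposed _ _ hv hw g hg.1 hg.2
  have hIX : ∀ {w : Place Ω} {v : Place K}, w.LiesOver v → v ∉ Sigma →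
      w.inertiaGroup K ≤ fieldStabilizer K Ω K'' := by
    intro w v hw hv g hg
    obtain ⟨u, hu⟩ := Place.exists_liesOver K'' w
    have h1 : AlgEquiv.restrictNormalHom K'' g ∈ u.inertiaGroup K :=
      Place.mem_inertiaGroup_iff.2 ((Place.mem_inertiaGroup_iff.1 hg).of_comp
        (Place.liesOver_iff.1 hu)
        (RingHom.ext fun x => (AlgEquiv.restrictNormal_commutes g K'' x).symm))
    rw [hunr u (not_liesOver_of_notMem (hu.of_tower hw) hv)] at h1
    rw [← hker]
    exact h1
  -- a local group meeting `Gal(Ω/K'')` inside `R` is cyclic modulo `R`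
  have hcyc : ∀ J ∈ localGroups Ω Sigma S T, J ⊓ fieldStabilizer K Ω K'' ≤ R →
      ∀ V : Subgroup Gal(Ω/K), V.Normal → R ≤ V → ∃ δ ∈ J, J ≤ Subgroup.zpowers δ ⊔ V := by
    intro J hJ hJR V hV hRV
    obtain ⟨c, hc⟩ := IsCyclic.exists_generator (α := Gal(K''/K))
    obtain ⟨δ, hδ, hδc⟩ : c ∈ J.map (AlgEquiv.restrictNormalHom K'') :=
      hmap J hJ ▸ Subgroup.mem_top c
    refine ⟨δ, hδ, fun d hd => ?_⟩
    obtain ⟨j, hj⟩ := hc (AlgEquiv.restrictNormalHom K'' d)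
    have hj' : c ^ j = AlgEquiv.restrictNormalHom K'' d := hj
    have hmem : δ ^ (-j) * d ∈ V := by
      refine hRV (hJR ⟨J.mul_mem (J.zpow_mem hδ _) hd, ?_⟩)
      rw [← hker]
      change AlgEquiv.restrictNormalHom K'' (δ ^ (-j) * d) = 1
      rw [map_mul, map_zpow, hδc, ← hj', ← zpow_add, neg_add_cancel, zpow_zero]
    have := Subgroup.mul_mem_sup (Subgroup.zpow_mem _ (Subgroup.mem_zpowers δ) j) hmem
    rwa [← mul_assoc, ← zpow_add, add_neg_cancel, zpow_zero, one_mul] at this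
  obtain ⟨J₀, hJ₀, hJ₀R⟩ : ∃ J₀ ∈ localGroups Ω Sigma S T, J₀ ⊓ fieldStabilizer K Ω K'' ≤ R := by
    obtain ⟨v, hv⟩ := hne
    obtain ⟨w, hw⟩ := Place.exists_liesOver_of_isAlgebraic Ω v
    rcases hv with hv | hv
    · exact ⟨_, ⟨w, Or.inl ⟨v, hv, hw, rfl⟩⟩, hIR hw fun h => hv.2 (Or.inl h)⟩
    · exact ⟨_, ⟨w, Or.inr ⟨v, hT₀ hv, hw, rfl⟩⟩, hDR hw hv⟩
  rw [← hker] at hinj hJ₀R ⊢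
  refine inf_ker_le_of_forall_closed hcard _ ?_ R _ _ ?_ ?_ ?_ ?_ ?_ ?_ ?_
    {m | ∃ n : ℕ, e = n ∧ m = p ^ n} ?_ (localGroups Ω Sigma S T) ?_ hmap ?_ J₀ hJ₀ hJ₀R ?_ hinj
  · rw [hker]; exact isOpen_fieldStabilizer K K'' Ω
  · exact InfiniteGalois.fixingSubgroup_isClosed _
  · exact InfiniteGalois.fixingSubgroup_isClosed _
  · intro g hg
    rw [hker]
    exact mem_fieldStabilizer.2 fun x => mem_fixingSubgroup_admissibleField.1 hg _
      (isAdmissibleElt_of_fixed fun h hh => mem_fieldStabilizer.1 hh x)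
  · intro g hg
    exact mem_fixingSubgroup_admissibleField.2 fun x hx =>
      mem_fixingSubgroup_admissibleField.1 hg x (hx.mono hT₀ le_top)
  · intro x hx y hy
    rw [hker] at hx hy
    exact commutatorElement_mem_fixingSubgroup hx hy
  · intro x hx O hO hRO
    rw [hker] at hx
    have hEO : (IntermediateField.fixedField O).fixingSubgroup = O :=
      InfiniteGalois.fixingSubgroup_fixedField ⟨O, Subgroup.isClosed_of_isOpen O hO⟩
    have : FiniteDimensional K (IntermediateField.fixedField O) := by
      refine (InfiniteGalois.isOpen_iff_finite _).1 ?_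
      change IsOpen ((IntermediateField.fixedField O).fixingSubgroup : Set Gal(Ω/K))
      rwa [hEO]
    have hle : IntermediateField.fixedField O
        ≤ admissibleField p e S T₀ (fieldStabilizer K Ω K'') := by
      rw [← InfiniteGalois.fixedField_fixingSubgroup (admissibleField p e S T₀ _)]
      exact IntermediateField.fixedField_antitone hRO
    obtain ⟨n, hn⟩ := exists_pow_forall_mem (IntermediateField.fixedField O)
      fun y hy => (mem_admissibleField.1 (hle hy)).pro_p x hx
    exact ⟨n, hEO ▸ (mem_fixingSubgroup_iff Gal(Ω/K)).2 hn⟩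
  · intro g h
    exact commutatorElement_mem_fixingSubgroup trivial trivial
  · rintro m ⟨n, hn, rfl⟩ x hx
    rw [hker] at hx
    exact mem_fixingSubgroup_admissibleField.2 fun y hy => hy.exponent n hn x hx
  · exact fun J hJ => le_fixingSubgroup_of_mem_localGroups hJ
  · intro J hJ V hV hVo hRV
    obtain ⟨w, ⟨v, hv, hw, rfl⟩ | ⟨v, hv, hw, rfl⟩⟩ := id hJ
    · exact hcyc _ hJ (hIR hw fun h => hv.2 (Or.inl h)) V hV hRV
    · by_cases hvT : v ∈ T₀
      · exact hcyc _ hJ (hDR hw hvT) V hV hRV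
      · -- here `v` is unramified in `K''/K`, hence its inertia group lies in `R`
        have hvs : v ∉ Sigma := fun h => hvT (hST₀ ⟨h, hv⟩)
        have hvS : v ∉ S := fun h => (hST ▸ (⟨h, hv⟩ : v ∈ S ∩ T) : v ∈ (∅ : Set (Place K)))
        exact exists_decompositionGroup_le_zpowers_sup V hVo
          (((le_inf le_rfl (hIX hw hvs)).trans (hIR hw hvS)).trans hRV)
  · intro W hWc hRW hcomm hexp hJW
    have hWf : (IntermediateField.fixedField W).fixingSubgroup = W :=
      InfiniteGalois.fixingSubgroup_fixedField ⟨W, hWc⟩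
    simp only [restrictNormalHom_pow_eq_one_iff hp hK' hK''] at hcomm hexp hJW
    have hfix : ∀ {g : Gal(Ω/K)} {x : Ω}, x ∈ IntermediateField.fixedField W → g ∈ W →
        g x = x := fun hx hg => (IntermediateField.mem_fixedField_iff _ _).1 hx _ hg
    -- the fixed field of `W` is admissible over `K'`
    have hle : IntermediateField.fixedField W
        ≤ admissibleField p e S T (fieldStabilizer K Ω K') := by
      intro x hx
      have hxR : IsAdmissibleElt p e S T₀ (fieldStabilizer K Ω K'') x := by
        rw [← mem_admissibleField,
          ← InfiniteGalois.fixedField_fixingSubgroup (admissibleField p e S T₀ _)]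
        exact IntermediateField.fixedField_antitone hRW hx
      refine ⟨fun g hg h hh => ?_, fun g hg => ?_, fun w hw g hg hgU => ?_,
        fun w v hv hwv g hg hgU => ?_, fun n hn g hg => ?_⟩
      · have h1 := hfix hx (hcomm _ _ (Subgroup.inv_mem _ hh) (Subgroup.inv_mem _ hg))
        rw [commutatorElement_def, inv_inv, inv_inv] at h1
        have h2 : g (h x) = (g * h) ((h⁻¹ * g⁻¹ * h * g) x) := by rw [h1]; rfl
        rw [h2, ← AlgEquiv.mul_apply, ← AlgEquiv.mul_apply]
        congr 1
        group
      · have hg2 : g ^ p ^ 2 ∈ fieldStabilizer K Ω K'' := by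
          rw [← hker, MonoidHom.mem_ker, map_pow, ← hcard, pow_card_eq_one']
        obtain ⟨n, hn⟩ := hxR.pro_p _ hg2
        exact ⟨2 + n, by rw [pow_add, pow_mul, hn]⟩
      · obtain ⟨v, hv⟩ := Place.exists_liesOver K w
        have hvS : v ∉ S := fun h => hw v h hv
        by_cases hvT : v ∈ T
        · exact hfix hx (hJW _ ⟨w, Or.inr ⟨v, hvT, hv, rfl⟩⟩ g
            (Place.inertiaGroup_le_decompositionGroup w hg) hgU)
        by_cases hvs : v ∈ Sigma
        · exact hfix hx (hJW _ ⟨w, Or.inl ⟨v, ⟨hvs, fun h => h.elim hvS hvT⟩, hv, rfl⟩⟩ g hg hgU)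
        · exact hfix hx (hRW (hIR hv hvS ⟨hg, hIX hv hvs hg⟩))
      · exact hfix hx (hJW _ ⟨w, Or.inr ⟨v, hv, hwv, rfl⟩⟩ g hg hgU)
      · exact hfix hx (hexp _ ⟨n, hn, rfl⟩ g hg)
    calc _ ≤ (IntermediateField.fixedField W).fixingSubgroup :=
          IntermediateField.fixingSubgroup_antitone hle
      _ = W := hWf

/-- `K''` and `L_{S,e}^T(K)` are linearly disjoint over `K`: some inertia or decomposition group is
trivial on the second field and is the whole Galois group on the first. -/
theorem exists_mem_fieldStabilizer_eqOn (hp : p.Prime) [IsGalois K K''] [IsCyclic Gal(K''/K)]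
    (hK' : Module.finrank K K' = p) (hK'' : Module.finrank K K'' = p ^ 2)
    (h1 : ((Sigma \ S) ∪ T).Nonempty)
    (h2 : TotallyRamifiedOver K K K'' (Sigma \ (S ∪ T))) (h3 : NonSplit K K' T) (e : ℕ∞)
    (g : Gal(Ω/K)) : ∃ h ∈ fieldStabilizer K Ω K'', ∀ x,
      IsAdmissibleElt p e S T (⊤ : Subgroup Gal(Ω/K)) x → h x = g x := by
  obtain ⟨J, hJ⟩ : (localGroups Ω Sigma S T).Nonempty := by
    obtain ⟨v, hv⟩ := h1
    obtain ⟨w, hw⟩ := Place.exists_liesOver_of_isAlgebraic Ω v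
    by_cases hvT : v ∈ T
    · exact ⟨_, w, Or.inr ⟨v, hvT, hw, rfl⟩⟩
    · have hv := hv.resolve_right hvT
      exact ⟨_, w, Or.inl ⟨v, ⟨hv.1, fun h => h.elim hv.2 hvT⟩, hw, rfl⟩⟩
  obtain ⟨j, hj, hjg⟩ : AlgEquiv.restrictNormalHom K'' g ∈
      J.map (AlgEquiv.restrictNormalHom K'') :=
    map_eq_top_of_mem_localGroups hp hK' hK'' h2 h3 hJ ▸ Subgroup.mem_top _
  refine ⟨g * j⁻¹, ?_, fun x hx => ?_⟩
  · rw [← ker_restrictNormalHom, MonoidHom.mem_ker, map_mul, map_inv, hjg, mul_inv_cancel]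
  · rw [AlgEquiv.mul_apply, mem_fixingSubgroup_admissibleField.1
      (le_fixingSubgroup_of_mem_localGroups hJ (J.inv_mem hj)) x hx]

end

/-! ### Restriction homomorphisms -/

section

variable {F F' Ω : Type*} [Field F] [Field F'] [Field Ω] [Algebra F F'] [Algebra F Ω]
  [Algebra F' Ω] [IsScalarTower F F' Ω]

theorem continuous_restriction [Algebra.IsAlgebraic F Ω] {L : IntermediateField F Ω} [Normal F L]
    {L' : IntermediateField F' Ω} (h : (L : Set Ω) ⊆ L') : Continuous (restriction h) := by
  have hF' : Algebra.IsAlgebraic F' Ω := Algebra.IsAlgebraic.tower_top (K := F) F'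
  refine continuous_of_continuousAt_one _ ?_
  rw [ContinuousAt, map_one]
  intro s hs
  obtain ⟨E, hE, hEs⟩ := (krullTopology_mem_nhds_one_iff F L s).1 hs
  have ho : ∀ i, IsOpen (MulAction.stabilizer Gal(L'/F')
      (⟨_, h (Module.finBasis F E i).1.2⟩ : L') : Set Gal(L'/F')) := fun i =>
    stabilizer_isOpen_of_isIntegral _
  refine Filter.mem_map.2 (Filter.mem_of_superset
    ((isOpen_iInter_of_finite ho).mem_nhds (Set.mem_iInter.2 fun i => one_mem _)) ?_)
  intro σ hσ
  refine hEs ((mem_fixingSubgroup_iff Gal(L/F)).2 fun x hx => ?_)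
  have hl : ((restriction h σ).toLinearMap ∘ₗ E.val.toLinearMap) = E.val.toLinearMap := by
    refine (Module.finBasis F E).ext fun i => Subtype.ext ?_
    have h1 := Set.mem_iInter.1 hσ i
    exact (coe_restriction_apply h σ _).trans (congrArg Subtype.val h1)
  exact LinearMap.congr_fun hl ⟨x, hx⟩

theorem isHomeomorph_restriction [IsGalois F Ω] [IsGalois F' Ω] {L : IntermediateField F Ω}
    [Normal F L] {L' : IntermediateField F' Ω} [Normal F' L'] (h : (L : Set Ω) ⊆ L')
    (hb : Function.Bijective (restriction h)) : IsHomeomorph (restriction h) := by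
  have : IsGalois F' L' := { to_isSeparable := Algebra.isSeparable_tower_bot_of_isSeparable F' L' Ω }
  exact isHomeomorph_iff_continuous_bijective.2 ⟨continuous_restriction h, hb⟩

end

theorem exists_gal_lift {F Ω : Type*} [Field F] [Field Ω] [Algebra F Ω] [Normal F Ω]
    {L : IntermediateField F Ω} [Normal F L] (a : Gal(L/F)) :
    ∃ g : Gal(Ω/F), ∀ x : L, (a x : Ω) = g x := by
  obtain ⟨g, rfl⟩ := AlgEquiv.restrictNormalHom_surjective (F := F) (K₁ := L) Ω a
  exact ⟨g, fun x => AlgEquiv.restrictNormal_commutes g L x⟩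

theorem exists_restrict {k F Ω : Type*} [Field k] [Field F] [Field Ω] [Algebra k Ω] [Algebra F Ω]
    (L : IntermediateField F Ω) [Normal F L] {g : Gal(Ω/k)}
    (hg : g ∈ fieldStabilizer k Ω F) : ∃ a : Gal(L/F), ∀ x : L, (a x : Ω) = g x := by
  obtain ⟨g', hg'⟩ := exists_gal_of_mem_fieldStabilizer hg
  exact ⟨g'.restrictNormal L, fun x => (AlgEquiv.restrictNormal_commutes g' L x).trans
    (RingHom.congr_fun hg' x)⟩

theorem fieldStabilizer_self {k Ω : Type*} [Field k] [Field Ω] [Algebra k Ω] :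
    fieldStabilizer k Ω k = ⊤ :=
  eq_top_iff.2 fun g _ => mem_fieldStabilizer.2 g.commutes

end ClassStability

open ClassStability in
/-- The tower `K ⊆ K' ⊆ K''` lies in a fixed algebraic closure `Ω` of `K`. The inclusions
that make the restriction mappings meaningful are part of the conclusion. -/
theorem mainTheorem1 (p : ℕ) (hp : p.Prime)
    {K : Type*} [Field K] [CharZero K] [Algebra.IsAlgebraic ℚ K]
    {K' K'' Ω : Type*} [Field K'] [Field K''] [Field Ω]
    [Algebra K K'] [Algebra K K''] [Algebra K' K''] [IsScalarTower K K' K'']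
    [Algebra K Ω] [Algebra K' Ω] [Algebra K'' Ω]
    [IsScalarTower K K' Ω] [IsScalarTower K K'' Ω] [IsScalarTower K' K'' Ω] [IsAlgClosure K Ω]
    (Sigma S T : Set (Place K)) (hST : S ∩ T = ∅)
    (hK' : Module.finrank K K' = p) (hK'' : Module.finrank K K'' = p ^ 2)
    (hGal : IsGalois K K'') (hcyc : IsCyclic Gal(K''/K))
    (hunr : UnramifiedOutside K K K'' Sigma)
    (h1 : ((Sigma \ S) ∪ T).Nonempty)
    (h2 : TotallyRamifiedOver K K K'' (Sigma \ (S ∪ T)))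
    (h3 : NonSplit K K' T)
    (e : ℕ∞) (he : e ≠ 0) :
    ∃ (i : (maxExt p e S T K Ω : Set Ω) ⊆ maxExt p e S T K' Ω)
      (i' : (maxExt p e S T K' Ω : Set Ω) ⊆ maxExt p e S T K'' Ω)
      (i'' : (maxExt p e S T K'' Ω : Set Ω) ⊆ maxExt p e S (Sigma ∩ T) K'' Ω),
      Function.Surjective (restriction i : A p e S T K' Ω →* A p e S T K Ω) ∧
      (Function.Bijective (restriction i : A p e S T K' Ω →* A p e S T K Ω) →
        IsHomeomorph (restriction i' : A p e S T K'' Ω →* A p e S T K' Ω) ∧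
        IsHomeomorph (restriction i : A p e S T K' Ω →* A p e S T K Ω) ∧
        ((Sigma \ S).Nonempty →
          IsHomeomorph
            (restriction i'' : A p e S (Sigma ∩ T) K'' Ω →* A p e S T K'' Ω))) := by
  have hΩ : IsGalois K Ω := IsAlgClosure.isGalois K Ω
  have hΩ' : IsGalois K' Ω := IsGalois.tower_top_of_isGalois K K' Ω
  have hΩ'' : IsGalois K'' Ω := IsGalois.tower_top_of_isGalois K K'' Ω
  have hle := fieldStabilizer_le K K' K'' Ω
  have hL : ∀ {x}, x ∈ maxExt p e S T K Ω ↔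
      IsAdmissibleElt p e S T (⊤ : Subgroup Gal(Ω/K)) x := fun {x} => by
    rw [mem_maxExt_iff (k := K) K, fieldStabilizer_self]
  have hL' : ∀ {x}, x ∈ maxExt p e S T K' Ω ↔
      IsAdmissibleElt p e S T (fieldStabilizer K Ω K') x := mem_maxExt_iff K'
  have hL'' : ∀ {T₀ : Set (Place K)} {x}, x ∈ maxExt p e S T₀ K'' Ω ↔
      IsAdmissibleElt p e S T₀ (fieldStabilizer K Ω K'') x := mem_maxExt_iff K''
  have i : (maxExt p e S T K Ω : Set Ω) ⊆ maxExt p e S T K' Ω :=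
    fun x hx => hL'.2 ((hL.1 hx).mono subset_rfl le_top)
  have i' : (maxExt p e S T K' Ω : Set Ω) ⊆ maxExt p e S T K'' Ω :=
    fun x hx => hL''.2 ((hL'.1 hx).mono subset_rfl hle)
  have i'' : (maxExt p e S T K'' Ω : Set Ω) ⊆ maxExt p e S (Sigma ∩ T) K'' Ω :=
    fun x hx => hL''.2 ((hL''.1 hx).mono Set.inter_subset_right le_rfl)
  -- every element of `A(K)` is induced by an automorphism of `Ω` over `K''`
  have hlift : ∀ a : A p e S T K Ω, ∃ g ∈ fieldStabilizer K Ω K'', ∀ x : maxExt p e S T K Ω,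
      (a x : Ω) = g x := by
    intro a
    obtain ⟨g, hg⟩ := exists_gal_lift a
    obtain ⟨h, hh, hhg⟩ := exists_mem_fieldStabilizer_eqOn hp hK' hK'' h1 h2 h3 e g
    exact ⟨h, hh, fun x => (hg x).trans (hhg x (hL.1 x.2)).symm⟩
  have hsurj : Function.Surjective (restriction i : A p e S T K' Ω →* A p e S T K Ω) := by
    intro a
    obtain ⟨g, hg, hga⟩ := hlift a
    obtain ⟨b, hb⟩ := exists_restrict (maxExt p e S T K' Ω) (hle hg)
    exact ⟨b, AlgEquiv.ext fun x => Subtype.ext <| by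
      rw [coe_restriction_apply, hb, hga]⟩
  refine ⟨i, i', i'', hsurj, fun hbij => ?_⟩
  have hinj : (admissibleField p e S T (⊤ : Subgroup Gal(Ω/K))).fixingSubgroup ⊓
      fieldStabilizer K Ω K'' ≤
        (admissibleField p e S T (fieldStabilizer K Ω K')).fixingSubgroup := by
    rintro g ⟨hg, hgU⟩
    obtain ⟨b, hb⟩ := exists_restrict (maxExt p e S T K' Ω) (hle hgU)
    have hb1 : b = 1 := hbij.1 <| AlgEquiv.ext fun x => Subtype.ext <| by
      rw [coe_restriction_apply, hb, map_one]
      exact mem_fixingSubgroup_admissibleField.1 hg x (hL.1 x.2)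
    refine mem_fixingSubgroup_admissibleField.2 fun x hx => ?_
    have := hb ⟨x, hL'.2 hx⟩
    rw [hb1] at this
    exact this.symm
  -- hence the only automorphism of `L_{S,e}^{T₀}(K'')` over `K''` and `L_{S,e}^T(K)` is trivial
  have htriv : ∀ T₀ : Set (Place K), T₀ ⊆ T → Sigma ∩ T ⊆ T₀ →
      (Sigma \ (S ∪ T) ∪ T₀).Nonempty → ∀ a : A p e S T₀ K'' Ω,
      (∀ (x : Ω) (_ : x ∈ maxExt p e S T K Ω) (hx : x ∈ maxExt p e S T₀ K'' Ω),
        (a ⟨x, hx⟩ : Ω) = x) → a = 1 := by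
    intro T₀ hT₀ hST₀ hne a ha
    obtain ⟨g, hg⟩ := exists_gal_lift a
    have hR := fixingSubgroup_inf_le hp hST hK' hK'' hunr h2 h3 e hT₀ hST₀ hne hinj
    have hmem : AlgEquiv.restrictScalarsHom K g ∈
        (admissibleField p e S T₀ (fieldStabilizer K Ω K'')).fixingSubgroup := by
      refine hR ⟨mem_fixingSubgroup_admissibleField.2 fun x hx => ?_,
        restrictScalars_mem_fieldStabilizer g⟩
      have hx'' : x ∈ maxExt p e S T₀ K'' Ω := hL''.2 (hx.mono hT₀ le_top)
      exact (hg ⟨x, hx''⟩).symm.trans (ha x (hL.2 hx) hx'')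
    exact AlgEquiv.ext fun x => Subtype.ext <| (hg x).trans
      (mem_fixingSubgroup_admissibleField.1 hmem x (hL''.1 x.2))
  refine ⟨isHomeomorph_restriction i' ⟨?_, fun b => ?_⟩, isHomeomorph_restriction i hbij,
    fun hne => isHomeomorph_restriction i'' ⟨?_, fun b => ?_⟩⟩
  · refine (injective_iff_map_eq_one _).2 fun a ha => htriv T subset_rfl Set.inter_subset_right
      ?_ a fun x hx hx'' => ?_
    · obtain ⟨v, hv⟩ := h1
      by_cases hvT : v ∈ T
      · exact ⟨v, Or.inr hvT⟩
      · have hv := hv.resolve_right hvT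
        exact ⟨v, Or.inl ⟨hv.1, fun h => h.elim hv.2 hvT⟩⟩
    · have := coe_restriction_apply i' a ⟨x, i hx⟩
      rw [ha] at this
      exact this.symm
  · obtain ⟨g, hg, hgb⟩ := hlift (restriction i b)
    obtain ⟨a, ha⟩ := exists_restrict (maxExt p e S T K'' Ω) hg
    refine ⟨a, hbij.1 (AlgEquiv.ext fun x => Subtype.ext ?_)⟩
    rw [coe_restriction_apply, coe_restriction_apply, ha, hgb]
  · refine (injective_iff_map_eq_one _).2 fun a ha => htriv (Sigma ∩ T) Set.inter_subset_right
      subset_rfl ?_ a fun x hx hx'' => ?_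
    · obtain ⟨v, hv⟩ := hne
      by_cases hvT : v ∈ T
      · exact ⟨v, Or.inr ⟨hv.1, hvT⟩⟩
      · exact ⟨v, Or.inl ⟨hv.1, fun h => h.elim hv.2 hvT⟩⟩
    · have := coe_restriction_apply i'' a ⟨x, i' (i hx)⟩
      rw [ha] at this
      exact this.symm
  · obtain ⟨g, hg⟩ := exists_gal_lift b
    obtain ⟨a, ha⟩ := exists_restrict (maxExt p e S (Sigma ∩ T) K'' Ω)
      (restrictScalars_mem_fieldStabilizer (k := K) g)
    refine ⟨a, AlgEquiv.ext fun x => Subtype.ext ?_⟩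
    rw [coe_restriction_apply, ha, hg]
    rfl
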